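/- Work in $\mathrm{ZFU_R}$: Zermelo--Fraenkel set theory, without the Axiom of Choice, in the language with $\in$ and a unary predicate for urelements, with the axioms Extensionality for sets, "urelements have no members", Foundation, Pairing, Union, Powerset, Infinity, and the schemata of Separation and Replacement (not Collection); the urelements may form a proper class. Sets are the objects that are not urelements. An ordinal is a transitive set, with no urelement in its transitive closure, that is well-ordered by $\in$. For a set $A$ of urelements put $V_0(A)=A$, $V_{\alpha+1}(A)=P(V_\alpha(A))\cup A$, $V_\gamma(A)=\bigcup_{\alpha<\gamma}V_\alpha(A)$ for limit $\gamma$, and $V(A)=\bigcup_{\alpha\in \mathrm{Ord}}V_\alpha(A)$. A set $A$ of urelements is universal if every set injects into $V(A)$. Plenitude$^+$ says that every set is equinumerous with a set of urelements. The Reflection Principle is the schema saying, for each formula $\varphi(x_1,\dots,x_n)$: for every set $x$ there is a transitive set $t$ with $x\subseteq t$ such that for all $x_1,\dots,x_n\in t$, $\varphi(x_1,\dots,x_n)\leftrightarrow\varphi^t(x_1,\dots,x_n)$, where $\varphi^t$ is $\varphi$ with all quantifiers restricted to $t$. Lemma. If there is a universal set of urelements, then Plenitude$^+$ implies the Reflection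 Principle. That is, in every model of $\mathrm{ZFU_R}$ in which some set of urelements is universal and Plenitude$^+$ holds, every instance of the Reflection Principle holds. -/

import Mathlib

open FirstOrder

namespace UrelementSet

/-- The non-logical symbols of urelement set theory: a binary relation symbol for membership and
a unary predicate symbol for "is an urelement". -/
inductive Symbols : ℕ → Type
  | ur : Symbols 1
  | mem : Symbols 2

/-- The first-order language of urelement set theory. -/
def lang : Language where
  Functions := fun _ => Empty
  Relations := Symbols

section Notions

universe u

variable {M : Type u} [lang.Structure M]

/-- `x` is an urelement. -/
def IsUr (x : M) : Prop :=
  Language.Structure.RelMap (L := lang) Symbols.ur ![x]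

/-- The membership relation of the structure. -/
def Mem (x y : M) : Prop :=
  Language.Structure.RelMap (L := lang) Symbols.mem ![x, y]

infix:50 " ∈ᵤ " => Mem

/-- Sets are the objects which are not urelements. -/
def IsSet (x : M) : Prop := ¬ IsUr x

/-- Every member of `x` is a member of `y`. -/
def Sub (x y : M) : Prop := ∀ z : M, z ∈ᵤ x → z ∈ᵤ y

/-- `x` is the empty set. -/
def IsEmptySet (x : M) : Prop := IsSet x ∧ ∀ z : M, ¬ z ∈ᵤ x

/-- `p` is the unordered pair `{a, b}`. -/
def IsPair (p a b : M) : Prop := IsSet p ∧ ∀ z : M, z ∈ᵤ p ↔ z = a ∨ z = b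

/-- `s` is the successor `x ∪ {x}`. -/
def IsSucc (s x : M) : Prop := IsSet s ∧ ∀ z : M, z ∈ᵤ s ↔ z ∈ᵤ x ∨ z = x

/-- `p` is the Kuratowski ordered pair `⟨a, b⟩ = {{a}, {a, b}}`. -/
def IsOrdPair (p a b : M) : Prop :=
  ∃ s d : M, IsPair s a a ∧ IsPair d a b ∧ IsPair p s d

/-- `f` contains the ordered pair `⟨a, b⟩`; for a function `f` this says `f(a) = b`. -/
def Maps (f a b : M) : Prop := ∃ p : M, IsOrdPair p a b ∧ p ∈ᵤ f

/-- `f` is a function (a set of ordered pairs) with domain `x`. -/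
def IsFunOn (f x : M) : Prop :=
  IsSet f ∧
  (∀ p : M, p ∈ᵤ f → ∃ a b : M, IsOrdPair p a b) ∧
  (∀ a b c : M, Maps f a b → Maps f a c → b = c) ∧
  (∀ a : M, a ∈ᵤ x ↔ ∃ b : M, Maps f a b)

/-- `f` is an injective function with domain `x`. -/
def IsInjOn (f x : M) : Prop :=
  IsFunOn f x ∧ ∀ a b c : M, Maps f a c → Maps f b c → a = b

/-- `x ∼ y`: there is a bijection from `x` to `y`. -/
def Equinumerous (x y : M) : Prop :=
  ∃ f : M, IsInjOn f x ∧ ∀ b : M, b ∈ᵤ y ↔ ∃ a : M, Maps f a b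

/-- There is an injection from the set `x` into the class `C`. -/
def InjectsInto (x : M) (C : M → Prop) : Prop :=
  ∃ f : M, IsInjOn f x ∧ ∀ a b : M, Maps f a b → C b

/-- `t` is a transitive set. -/
def IsTrans (t : M) : Prop :=
  IsSet t ∧ ∀ x y : M, x ∈ᵤ t → y ∈ᵤ x → y ∈ᵤ t

/-- `y` belongs to the transitive closure of `{x}`, the least transitive set having `x` as a
member. -/
def InTC (y x : M) : Prop := ∀ t : M, IsTrans t → x ∈ᵤ t → y ∈ᵤ t

/-- `x` is a pure set: its kernel, the set of all urelements in the transitive closure of `{x}`,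
is empty. -/
def IsPure (x : M) : Prop := ∀ y : M, InTC y x → ¬ IsUr y

/-- `x` is an ordinal: a transitive pure set which is (strictly) well-ordered by membership. -/
def IsOrd (x : M) : Prop :=
  IsTrans x ∧ IsPure x ∧
  (∀ a : M, a ∈ᵤ x → ¬ a ∈ᵤ a) ∧
  (∀ a b c : M, a ∈ᵤ x → b ∈ᵤ x → c ∈ᵤ x → a ∈ᵤ b → b ∈ᵤ c → a ∈ᵤ c) ∧
  (∀ a b : M, a ∈ᵤ x → b ∈ᵤ x → a ∈ᵤ b ∨ a = b ∨ b ∈ᵤ a) ∧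
  (∀ s : M, Sub s x → (∃ a : M, a ∈ᵤ s) →
    ∃ m : M, m ∈ᵤ s ∧ ∀ a : M, a ∈ᵤ s → m = a ∨ m ∈ᵤ a)

/-- `A` is a set of urelements. -/
def IsUrSet (A : M) : Prop := IsSet A ∧ ∀ a : M, a ∈ᵤ A → IsUr a

/-- `α` is a limit ordinal. -/
def IsLimitOrd (α : M) : Prop :=
  IsOrd α ∧ ¬ IsEmptySet α ∧ ¬ ∃ β : M, IsOrd β ∧ IsSucc α β

/-- `f` is the sequence `⟨V_β(A) : β < δ⟩`, where `V_0(A) = A`,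
`V_{β+1}(A) = P(V_β(A)) ∪ A`, and `V_γ(A) = ⋃_{β < γ} V_β(A)` for limit `γ`. -/
def IsHierarchy (A δ f : M) : Prop :=
  IsOrd δ ∧ IsFunOn f δ ∧
  ∀ β v : M, Maps f β v →
    (IsEmptySet β → v = A) ∧
    (∀ γ w : M, IsSucc β γ → Maps f γ w →
      IsSet v ∧ ∀ z : M, z ∈ᵤ v ↔ (IsSet z ∧ Sub z w) ∨ z ∈ᵤ A) ∧
    (IsLimitOrd β →
      IsSet v ∧ ∀ z : M, z ∈ᵤ v ↔ ∃ γ w : M, γ ∈ᵤ β ∧ Maps f γ w ∧ z ∈ᵤ w)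

/-- `x` belongs to the class `V(A)`, the union of all `V_α(A)` for ordinals `α`. -/
def InV (A x : M) : Prop :=
  ∃ δ f α v : M, IsHierarchy A δ f ∧ Maps f α v ∧ x ∈ᵤ v

/-- `A` is a universal set of urelements: every set injects into `V(A)`. -/
def IsUniversal (A : M) : Prop :=
  IsUrSet A ∧ ∀ x : M, IsSet x → InjectsInto x (InV A)

/-- The truth value of the relativization `φ^D`, in which every quantifier of `φ` is restricted
to the class `D`, under the assignment `v` to the free and `xs` to the bound variables. -/
def RealizeIn {α : Type} (D : M → Prop) :
    ∀ {n : ℕ}, lang.BoundedFormula α n → (α → M) → (Fin n → M) → Prop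
  | _, .falsum, _, _ => False
  | _, .equal t₁ t₂, v, xs => t₁.realize (Sum.elim v xs) = t₂.realize (Sum.elim v xs)
  | _, .rel R ts, v, xs =>
      Language.Structure.RelMap R fun i => (ts i).realize (Sum.elim v xs)
  | _, .imp φ ψ, v, xs => RealizeIn D φ v xs → RealizeIn D ψ v xs
  | _, .all φ, v, xs => ∀ x : M, D x → RealizeIn D φ v (Fin.snoc xs x)

end Notions

section Principles

universe u

variable (M : Type u) [lang.Structure M]

/-- `M` is a model of `ZFU_R`, Zermelo-Fraenkel set theory with (possibly a proper class of)
urelements, formulated with Replacement. In the two schemata, `Set.univ.Definable₁ lang` and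
`Set.univ.Definable₂ lang` range over the unary and binary predicates defined by first-order
formulas with arbitrary parameters from `M`. -/
structure ModelsZFUR : Prop where
  urelements : ∀ a x : M, IsUr a → ¬ x ∈ᵤ a
  extensionality : ∀ x y : M, IsSet x → IsSet y → (∀ z : M, z ∈ᵤ x ↔ z ∈ᵤ y) → x = y
  foundation : ∀ x : M, (∃ y : M, y ∈ᵤ x) → ∃ y : M, y ∈ᵤ x ∧ ∀ z : M, z ∈ᵤ x → ¬ z ∈ᵤ y
  pairing : ∀ a b : M, ∃ p : M, IsPair p a b
  union : ∀ x : M, ∃ y : M, IsSet y ∧ ∀ z : M, z ∈ᵤ y ↔ ∃ w : M, w ∈ᵤ x ∧ z ∈ᵤ w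
  powerset : ∀ x : M, IsSet x →
    ∃ y : M, IsSet y ∧ ∀ z : M, z ∈ᵤ y ↔ IsSet z ∧ Sub z x
  infinity : ∃ w : M, IsSet w ∧ (∃ e : M, IsEmptySet e ∧ e ∈ᵤ w) ∧
    ∀ x : M, x ∈ᵤ w → ∃ s : M, IsSucc s x ∧ s ∈ᵤ w
  separation : ∀ P : Set M, Set.univ.Definable₁ lang P →
    ∀ x : M, ∃ y : M, IsSet y ∧ ∀ z : M, z ∈ᵤ y ↔ z ∈ᵤ x ∧ z ∈ P
  replacement : ∀ R : Set (M × M), Set.univ.Definable₂ lang R →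
    ∀ w : M, (∀ x : M, x ∈ᵤ w → ∃! y : M, (x, y) ∈ R) →
      ∃ v : M, IsSet v ∧ ∀ x : M, x ∈ᵤ w → ∃ y : M, y ∈ᵤ v ∧ (x, y) ∈ R

/-- Plenitude⁺: every set is equinumerous with a set of urelements. -/
def PlenitudePlus : Prop :=
  ∀ x : M, IsSet x → ∃ A : M, IsUrSet A ∧ Equinumerous x A

/-- The Reflection Principle: for every formula `φ(x₁, …, xₙ)` and every set `x` there is a
transitive set `t ⊇ x` such that `φ(x₁, …, xₙ) ↔ φ^t(x₁, …, xₙ)` for all `x₁, …, xₙ ∈ t`. -/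
def ReflectionPrinciple : Prop :=
  ∀ (n : ℕ) (φ : lang.Formula (Fin n)) (x : M), IsSet x →
    ∃ t : M, IsTrans t ∧ Sub x t ∧
      ∀ a : Fin n → M, (∀ i, a i ∈ᵤ t) →
        (φ.Realize a ↔ RealizeIn (fun y => y ∈ᵤ t) φ a default)

end Principles

end UrelementSet

/-! The usual closing-off argument for reflection needs Collection: witnesses for parameters from a
set may involve ever new urelements and need not lie in one set. Symmetry replaces Collection.
Enlarge the universal set to a set A that also contains the urelements in the transitive closure of
x. A definable automorphism of the universe fixing A pointwise preserves truth and fixes every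
object with kernel in A, in particular every level of the hierarchy over A. Up to such automorphisms
only the rank of a witness and the size of its kernel outside A matter. By universality that part of
the kernel injects into a level over A, so a level m bounds both.

Bounding: by Plenitude⁺ one fixed set of urelements outside A receives copies of all those that
inject into l × P(l), and the copying is done by automorphisms over A
(`PlenitudePlus.exists_defAut`). So for a given level l only a set of parameter tuples has to be
treated. Each has a least level bounding a counterexample, levels are comparable, and Replacement
yields a common bound m (`exists_level_closesUnder`). Iterating along ω gives a set C of levels
closed under bounding (`exists_closed_levels`).

Reflecting set: Plenitude⁺ assigns to each N in C a reserved block of urelements outside A, one for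
each member of N. Let S(l) be the stage indexed by l over A together with the blocks of all N ⊆ l,
and let t be the union of the S(l). If parameters lie in S(l) and m bounds a counterexample, an
automorphism fixing the parameters moves the new urelements of the counterexample into the block of
m, which is unused because l ∈ m. The counterexample thereby lands in S(m), and t passes the
Tarski–Vaught test. -/

namespace UrelementSet

universe u

/-! ### Definability with parameters, arranged so that instance search verifies it. -/

section Definability

variable {M : Type u} [lang.Structure M] {ι κ : Type}

/-- A predicate on environments `ι → M` that is first-order definable with parameters. -/
class DefPred (P : (ι → M) → Prop) : Prop where
  definable : Set.univ.Definable lang {v | P v}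

/-- A function of the environment whose graph is first-order definable with parameters. -/
class DefTerm (t : (ι → M) → M) : Prop where
  graph : DefPred fun w : ι ⊕ Unit → M => w (.inr ()) = t fun i => w (.inl i)

/-- A definable unary predicate. -/
class DefSet (P : M → Prop) : Prop where
  out : DefPred fun v : Unit → M => P (v ())

/-- A definable binary predicate. -/
class DefRel (R : M → M → Prop) : Prop where
  out : DefPred fun v : Bool → M => R (v false) (v true)

/-- A definable class function. -/
class DefFun (g : M → M) : Prop where
  out : DefTerm fun v : Unit → M => g (v ())

/-- A definable class function of two variables. -/
class DefFun₂ (g : M → M → M) : Prop where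
  out : DefTerm fun v : Bool → M => g (v false) (v true)

theorem DefPred.congr {P Q : (ι → M) → Prop} (hP : DefPred P) (h : ∀ v, Q v ↔ P v) :
    DefPred Q := by
  obtain rfl : Q = P := funext fun v => propext (h v)
  exact hP

theorem DefTerm.of_graph {t : (ι → M) → M} {P : (ι → M) → M → Prop}
    (h : DefPred fun w : ι ⊕ Unit → M => P (fun i => w (.inl i)) (w (.inr ())))
    (ht : ∀ v y, y = t v ↔ P v y) : DefTerm t :=
  ⟨h.congr fun _ => ht _ _⟩

instance DefPred.and {P Q : (ι → M) → Prop} [hP : DefPred P] [hQ : DefPred Q] :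
    DefPred fun v => P v ∧ Q v :=
  ⟨hP.1.inter hQ.1⟩

instance DefPred.or {P Q : (ι → M) → Prop} [hP : DefPred P] [hQ : DefPred Q] :
    DefPred fun v => P v ∨ Q v :=
  ⟨hP.1.union hQ.1⟩

instance DefPred.not {P : (ι → M) → Prop} [hP : DefPred P] : DefPred fun v => ¬ P v :=
  ⟨hP.1.compl⟩

instance DefPred.imp {P Q : (ι → M) → Prop} [hP : DefPred P] [hQ : DefPred Q] :
    DefPred fun v => P v → Q v :=
  (DefPred.or (P := fun v => ¬ P v) (Q := Q)).congr fun _ => imp_iff_not_or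

instance DefPred.iff {P Q : (ι → M) → Prop} [hP : DefPred P] [hQ : DefPred Q] :
    DefPred fun v => P v ↔ Q v :=
  (DefPred.and (P := fun v => P v → Q v) (Q := fun v => Q v → P v)).congr fun _ =>
    iff_iff_implies_and_implies

instance DefPred.const {p : Prop} : DefPred fun _ : ι → M => p := by
  by_cases hp : p
  · exact ⟨by simp [hp]⟩
  · exact ⟨by simp [hp]⟩

theorem DefPred.preimage_comp {P : (ι → M) → Prop} (hP : DefPred P) (f : ι → κ) :
    DefPred fun w : κ → M => P fun i => w (f i) :=
  ⟨hP.1.preimage_comp f⟩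

theorem DefPred.exists_tuple [Finite κ] {P : (ι → M) → (κ → M) → Prop}
    (h : DefPred fun w : ι ⊕ κ → M => P (fun i => w (.inl i)) (fun k => w (.inr k))) :
    DefPred fun v => ∃ u, P v u :=
  ⟨h.1.exists_of_finite⟩

theorem DefPred.forall_tuple [Finite κ] {P : (ι → M) → (κ → M) → Prop}
    (h : DefPred fun w : ι ⊕ κ → M => P (fun i => w (.inl i)) (fun k => w (.inr k))) :
    DefPred fun v => ∀ u, P v u :=
  ⟨h.1.forall_of_finite⟩

instance DefPred.exists {P : (ι → M) → M → Prop}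
    [h : DefPred fun w : ι ⊕ Unit → M => P (fun i => w (.inl i)) (w (.inr ()))] :
    DefPred fun v => ∃ y, P v y :=
  (DefPred.exists_tuple (κ := Unit) (P := fun v u => P v (u ())) h).congr fun _ =>
    ⟨fun ⟨y, hy⟩ => ⟨fun _ => y, hy⟩, fun ⟨u, hu⟩ => ⟨u (), hu⟩⟩

instance DefPred.forall {P : (ι → M) → M → Prop}
    [h : DefPred fun w : ι ⊕ Unit → M => P (fun i => w (.inl i)) (w (.inr ()))] :
    DefPred fun v => ∀ y, P v y :=
  (DefPred.forall_tuple (κ := Unit) (P := fun v u => P v (u ())) h).congr fun _ =>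
    ⟨fun h u => h (u ()), fun h y => h fun _ => y⟩

theorem DefPred.forall_finite [Finite κ] {P : κ → (ι → M) → Prop} (h : ∀ k, DefPred (P k)) :
    DefPred fun v => ∀ k, P k v := by
  have := Set.definable_iInter_of_finite fun k => (h k).1
  exact ⟨by convert this using 1; ext; simp⟩

instance DefTerm.var (i : ι) : DefTerm fun v : ι → M => v i := by
  refine ⟨⟨((Language.Term.var (Sum.inr ())).equal (Language.Term.var (Sum.inl i))), ?_⟩⟩
  ext v
  simp

instance DefTerm.const (c : M) : DefTerm fun _ : ι → M => c := by
  refine ⟨⟨((Language.Term.var (Sum.inr ())).equal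
    (lang.con (⟨c, trivial⟩ : (Set.univ : Set M))).term), ?_⟩⟩
  ext v
  simp

instance (priority := low) DefTerm.lift {t : (ι → M) → M} [ht : DefTerm t] (f : ι → κ) :
    DefTerm fun w : κ → M => t fun i => w (f i) :=
  ⟨ht.1.preimage_comp (Sum.map f id)⟩

/-- Substitution of definable terms into a definable predicate. -/
theorem DefPred.subst [Finite κ] {P : (κ → M) → Prop} (hP : DefPred P) {t : κ → (ι → M) → M}
    (ht : ∀ k, DefTerm (t k)) : DefPred fun v => P fun k => t k v := by
  have h1 : DefPred fun w : ι ⊕ κ → M => ∀ k, w (.inr k) = t k fun i => w (.inl i) :=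
    DefPred.forall_finite fun k =>
      (ht k).1.preimage_comp (Sum.map id fun _ : Unit => k)
  have h2 : DefPred fun w : ι ⊕ κ → M => P fun k => w (.inr k) := hP.preimage_comp _
  -- The `t k` are not terms of the language, they only have definable graphs; their values are
  -- therefore introduced by an existential quantifier over tuples.
  refine (DefPred.exists_tuple (κ := κ)
    (P := fun v u => (∀ k, u k = t k v) ∧ P u) (DefPred.and)).congr fun v => ?_
  constructor
  · exact fun h => ⟨_, fun _ => rfl, h⟩
  · rintro ⟨u, hu, h⟩
    obtain rfl : u = fun k => t k v := funext hu
    exact h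

instance DefPred.eq {s t : (ι → M) → M} [hs : DefTerm s] [ht : DefTerm t] :
    DefPred fun v => s v = t v := by
  have h : DefPred fun v : Bool → M => v false = v true :=
    ⟨⟨(Language.Term.var false).equal (Language.Term.var true), by ext; simp⟩⟩
  exact h.subst (t := fun b => bif b then t else s) (by rintro (_ | _) <;> assumption)

theorem DefSet.comp {P : M → Prop} (hP : DefSet P) (t : (ι → M) → M) [ht : DefTerm t] :
    DefPred fun v => P (t v) :=
  hP.1.subst (t := fun _ => t) fun _ => ht

theorem DefRel.comp {R : M → M → Prop} (hR : DefRel R) (s t : (ι → M) → M) [hs : DefTerm s]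
    [ht : DefTerm t] : DefPred fun v => R (s v) (t v) :=
  hR.1.subst (t := fun b => bif b then t else s) (by rintro (_ | _) <;> assumption)

/-- Substitution of definable terms into a definable term. -/
theorem DefTerm.subst [Finite κ] {s : (κ → M) → M} (hs : DefTerm s) {t : κ → (ι → M) → M}
    (ht : ∀ k, DefTerm (t k)) : DefTerm fun v => s fun k => t k v := by
  refine ⟨hs.1.subst (ι := ι ⊕ Unit) (t := Sum.elim (fun k w => t k fun i => w (.inl i))
    fun _ w => w (.inr ())) ?_⟩
  rintro (k | k)
  · exact ⟨(ht k).1.preimage_comp (Sum.map Sum.inl id)⟩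
  · exact DefTerm.var _

theorem DefFun.comp {g : M → M} (hg : DefFun g) (t : (ι → M) → M) [ht : DefTerm t] :
    DefTerm fun v => g (t v) :=
  hg.1.subst (t := fun _ => t) fun _ => ht

theorem DefFun₂.comp {g : M → M → M} (hg : DefFun₂ g) (s t : (ι → M) → M) [hs : DefTerm s]
    [ht : DefTerm t] : DefTerm fun v => g (s v) (t v) :=
  hg.1.subst (t := fun b => bif b then t else s) (by rintro (_ | _) <;> assumption)

instance DefPred.isUr {t : (ι → M) → M} [ht : DefTerm t] : DefPred fun v => IsUr (t v) := by
  have h : DefPred fun v : Unit → M => IsUr (v ()) := by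
    have h : (∅ : Set M).Definable lang {v : Unit → M | IsUr (v ())} := by
      rw [Set.empty_definable_iff]
      refine ⟨Language.Relations.formula₁ (L := lang) (α := Unit) (Symbols.ur : lang.Relations 1)
        (Language.Term.var ()), ?_⟩
      ext v
      exact (Language.Formula.realize_rel₁ (L := lang) (M := M)
        (R := (Symbols.ur : lang.Relations 1)) (t := Language.Term.var ()) (v := v)).symm
    exact ⟨h.mono (Set.empty_subset _)⟩
  exact h.subst (t := fun _ => t) fun _ => ht

instance DefPred.mem {s t : (ι → M) → M} [hs : DefTerm s] [ht : DefTerm t] :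
    DefPred fun v => s v ∈ᵤ t v := by
  have h : DefPred fun v : Bool → M => v false ∈ᵤ v true := by
    have h : (∅ : Set M).Definable lang {v : Bool → M | v false ∈ᵤ v true} := by
      rw [Set.empty_definable_iff]
      refine ⟨Language.Relations.formula₂ (L := lang) (α := Bool)
        (Symbols.mem : lang.Relations 2) (Language.Term.var false) (Language.Term.var true), ?_⟩
      ext v
      exact (Language.Formula.realize_rel₂ (L := lang) (M := M)
        (R := (Symbols.mem : lang.Relations 2)) (t₁ := Language.Term.var false)
        (t₂ := Language.Term.var true) (v := v)).symm
    exact ⟨h.mono (Set.empty_subset _)⟩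
  exact h.subst (t := fun b => bif b then t else s) (by rintro (_ | _) <;> assumption)

instance DefPred.existsUnique {P : (ι → M) → M → Prop}
    [h : DefPred fun w : ι ⊕ Unit → M => P (fun i => w (.inl i)) (w (.inr ()))] :
    DefPred fun v => ∃! y, P v y := by
  have h' : DefPred fun w : (ι ⊕ Unit) ⊕ Unit → M =>
      P (fun i => w (.inl (.inl i))) (w (.inr ())) :=
    h.preimage_comp (Sum.map Sum.inl id)
  unfold ExistsUnique
  infer_instance

variable {a b c : (ι → M) → M} [DefTerm a] [DefTerm b] [DefTerm c]

instance : DefPred fun v => IsSet (a v) := by unfold IsSet; infer_instance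

instance : DefPred fun v => Sub (a v) (b v) := by unfold Sub; infer_instance

instance : DefPred fun v => IsPair (a v) (b v) (c v) := by unfold IsPair; infer_instance

instance : DefPred fun v => IsOrdPair (a v) (b v) (c v) := by unfold IsOrdPair; infer_instance

instance : DefPred fun v => Maps (a v) (b v) (c v) := by unfold Maps; infer_instance

instance : DefPred fun v => IsFunOn (a v) (b v) := by unfold IsFunOn; infer_instance

instance : DefPred fun v => IsInjOn (a v) (b v) := by unfold IsInjOn; infer_instance

instance : DefPred fun v => IsTrans (a v) := by unfold IsTrans; infer_instance

instance : DefPred fun v => InTC (a v) (b v) := by unfold InTC; infer_instance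

instance : DefPred fun v => IsUrSet (a v) := by unfold IsUrSet; infer_instance

instance DefPred.injectsInto {C : (ι → M) → M → Prop}
    [h : DefPred fun w : ι ⊕ Unit → M => C (fun i => w (.inl i)) (w (.inr ()))] :
    DefPred fun v => InjectsInto (a v) (C v) := by
  have h' : DefPred fun w : ((ι ⊕ Unit) ⊕ Unit) ⊕ Unit → M =>
      C (fun i => w (.inl (.inl (.inl i)))) (w (.inr ())) :=
    h.preimage_comp (Sum.map (Sum.inl ∘ Sum.inl) id)
  unfold InjectsInto
  infer_instance

/-- The truth set of a first-order formula is definable. -/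
theorem DefPred.realize {n : ℕ} (φ : lang.BoundedFormula ι n) :
    DefPred fun w : ι ⊕ Fin n → M => φ.Realize (fun i => w (.inl i)) fun j => w (.inr j) := by
  have h : (∅ : Set M).Definable lang
      {w : ι ⊕ Fin n → M | φ.Realize (fun i => w (.inl i)) fun j => w (.inr j)} := by
    rw [Set.empty_definable_iff]
    refine ⟨φ.toFormula, ?_⟩
    ext w
    exact (Language.BoundedFormula.realize_toFormula φ w).symm
  exact ⟨h.mono (Set.empty_subset _)⟩

end Definability

/-! ### Basic set formation from the axioms. -/

section BasicSets

variable {M : Type u} [lang.Structure M] {ι : Type}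

instance (priority := low) DefSet.of_defPred {P : M → Prop}
    [h : DefPred fun v : Unit → M => P (v ())] : DefSet P := ⟨h⟩

instance (priority := low) DefRel.of_defPred {R : M → M → Prop}
    [h : DefPred fun v : Bool → M => R (v false) (v true)] : DefRel R := ⟨h⟩

instance (priority := low) DefFun.of_defTerm {g : M → M}
    [h : DefTerm fun v : Unit → M => g (v ())] : DefFun g := ⟨h⟩

/-- The class `P` is a set. -/
def Small (P : M → Prop) : Prop := ∃ y : M, IsSet y ∧ ∀ z, z ∈ᵤ y ↔ P z

instance DefPred.small {P : (ι → M) → M → Prop}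
    [h : DefPred fun w : ι ⊕ Unit → M => P (fun i => w (.inl i)) (w (.inr ()))] :
    DefPred fun v => Small (P v) := by
  have h' : DefPred fun w : (ι ⊕ Unit) ⊕ Unit → M =>
      P (fun i => w (.inl (.inl i))) (w (.inr ())) :=
    h.preimage_comp (Sum.map Sum.inl id)
  unfold Small
  infer_instance

variable [hM : Fact (ModelsZFUR M)]

instance : Nonempty M := ⟨hM.1.infinity.choose⟩

open Classical in
/-- The set with extension `P`, if there is one. -/
noncomputable def coll (P : M → Prop) : M :=
  if h : Small P then h.choose else Classical.arbitrary M

theorem isSet_coll {P : M → Prop} (h : Small P) : IsSet (coll P) := by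
  rw [coll, dif_pos h]
  exact h.choose_spec.1

theorem mem_coll {P : M → Prop} (h : Small P) {z : M} : z ∈ᵤ coll P ↔ P z := by
  rw [coll, dif_pos h]
  exact h.choose_spec.2 z

theorem ext_set {x y : M} (hx : IsSet x) (hy : IsSet y) (h : ∀ z, z ∈ᵤ x ↔ z ∈ᵤ y) : x = y :=
  hM.1.extensionality x y hx hy h

theorem eq_coll {P : M → Prop} (h : Small P) {y : M} :
    y = coll P ↔ IsSet y ∧ ∀ z, z ∈ᵤ y ↔ P z := by
  constructor
  · rintro rfl
    exact ⟨isSet_coll h, fun z => mem_coll h⟩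
  · rintro ⟨hy, hz⟩
    exact ext_set hy (isSet_coll h) fun z => (hz z).trans (mem_coll h).symm

/-- The default value for proper classes is one fixed object, which may serve as a parameter, so the
graph is definable without any smallness assumption. -/
instance DefTerm.coll {P : (ι → M) → M → Prop}
    [h : DefPred fun w : ι ⊕ Unit → M => P (fun i => w (.inl i)) (w (.inr ()))] :
    DefTerm fun v => coll (P v) := by
  have h' : DefPred fun w : (ι ⊕ Unit) ⊕ Unit → M =>
      P (fun i => w (.inl (.inl i))) (w (.inr ())) :=
    h.preimage_comp (Sum.map Sum.inl id)
  refine DefTerm.of_graph (P := fun v y => (Small (P v) ∧ IsSet y ∧ ∀ z, z ∈ᵤ y ↔ P v z) ∨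
    ¬ Small (P v) ∧ y = Classical.arbitrary M) inferInstance fun v y => ?_
  by_cases hs : Small (P v)
  · simp [hs, eq_coll hs]
  · simp only [UrelementSet.coll, hs, dite_false, false_and, not_false_eq_true, true_and, false_or]

theorem isSet_of_mem {x y : M} (h : x ∈ᵤ y) : IsSet y :=
  fun hy => hM.1.urelements y x hy h

theorem small_of_sub {P : M → Prop} [hP : DefSet P] {x : M} (h : ∀ z, P z → z ∈ᵤ x) :
    Small P := by
  have hd : Set.univ.Definable₁ lang {z | P z} :=
    (hP.comp fun v : Fin 1 → M => v 0).1
  obtain ⟨y, hy, hz⟩ := hM.1.separation _ hd x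
  exact ⟨y, hy, fun z => (hz z).trans ⟨fun h => h.2, fun hp => ⟨h z hp, hp⟩⟩⟩

theorem small_sep (x : M) (P : M → Prop) [hP : DefSet P] : Small fun z => z ∈ᵤ x ∧ P z :=
  -- Definability of `P` at arbitrary terms is made a local instance, so that formulas mentioning
  -- `P` are handled automatically. The local `inst` facts below serve the same purpose.
  haveI : ∀ {ι : Type} (t : (ι → M) → M) [DefTerm t], DefPred fun v => P (t v) := hP.comp
  small_of_sub (x := x) fun _ h => h.1

/-- Replacement provides only a set containing all the values; Separation trims it to exactly the
values. -/
theorem small_image_rel {w : M} {R : M → M → Prop} [hR : DefRel R]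
    (h : ∀ x, x ∈ᵤ w → ∃! y, R x y) : Small fun y => ∃ x, x ∈ᵤ w ∧ R x y := by
  have inst {ι : Type} (s t : (ι → M) → M) [DefTerm s] [DefTerm t] :
    DefPred fun v => R (s v) (t v) := hR.comp s t
  have hd : Set.univ.Definable₂ lang {p : M × M | R p.1 p.2} :=
    (hR.comp (fun v : Fin 2 → M => v 0) fun v => v 1).1
  obtain ⟨v, -, hv⟩ := hM.1.replacement _ hd w h
  refine small_of_sub (x := v) ?_
  rintro y ⟨x, hx, hxy⟩
  obtain ⟨y', hy', hxy'⟩ := hv x hx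
  exact (h x hx).unique hxy hxy' ▸ hy'

theorem small_image (w : M) (g : M → M) [hg : DefFun g] :
    Small fun y => ∃ x, x ∈ᵤ w ∧ y = g x := by
  have inst {ι : Type} (t : (ι → M) → M) [DefTerm t] : DefTerm fun v => g (t v) := hg.comp t
  exact small_image_rel (R := fun x y => y = g x) fun x _ => ⟨g x, rfl, fun _ h => h⟩

theorem small_biUnion (w : M) (g : M → M) [hg : DefFun g] :
    Small fun z => ∃ x, x ∈ᵤ w ∧ z ∈ᵤ g x := by
  obtain ⟨y, hy, hz⟩ := hM.1.union (coll fun y => ∃ x, x ∈ᵤ w ∧ y = g x)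
  refine ⟨y, hy, fun z => (hz z).trans ?_⟩
  simp only [mem_coll (small_image w g)]
  constructor
  · rintro ⟨_, ⟨x, hx, rfl⟩, hz⟩
    exact ⟨x, hx, hz⟩
  · rintro ⟨x, hx, hz⟩
    exact ⟨_, ⟨x, hx, rfl⟩, hz⟩

theorem small_pow {x : M} (hx : IsSet x) : Small fun z => IsSet z ∧ Sub z x :=
  hM.1.powerset x hx

/-- The unordered pair. -/
noncomputable def pair (a b : M) : M := coll fun z => z = a ∨ z = b

instance {a b : (ι → M) → M} [DefTerm a] [DefTerm b] : DefTerm fun v => pair (a v) (b v) := by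
  unfold pair; infer_instance

theorem isPair_iff {p a b : M} : IsPair p a b ↔ p = pair a b :=
  (eq_coll (hM.1.pairing a b)).symm

@[simp] theorem mem_pair {a b z : M} : z ∈ᵤ pair a b ↔ z = a ∨ z = b :=
  mem_coll (hM.1.pairing a b)

theorem pair_inj {a b c : M} (h : pair a b = pair a c) : b = c := by
  have h1 : b ∈ᵤ pair a c := h ▸ mem_pair.2 (Or.inr rfl)
  have h2 : c ∈ᵤ pair a b := h ▸ mem_pair.2 (Or.inr rfl)
  rw [mem_pair] at h1 h2
  rcases h1 with rfl | h1
  · rcases h2 with rfl | rfl <;> rfl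
  · exact h1

/-- The Kuratowski ordered pair. -/
noncomputable def opair (a b : M) : M := pair (pair a a) (pair a b)

instance {a b : (ι → M) → M} [DefTerm a] [DefTerm b] : DefTerm fun v => opair (a v) (b v) := by
  unfold opair; infer_instance

theorem isOrdPair_iff {p a b : M} : IsOrdPair p a b ↔ p = opair a b := by
  simp [IsOrdPair, isPair_iff, opair]

theorem opair_inj {a b c d : M} : opair a b = opair c d ↔ a = c ∧ b = d := by
  refine ⟨fun h => ?_, by rintro ⟨rfl, rfl⟩; rfl⟩
  have hac : a = c := by
    have h1 : pair a a ∈ᵤ opair c d := h ▸ mem_pair.2 (Or.inl rfl)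
    rcases mem_pair.1 h1 with h1 | h1
    · have : a ∈ᵤ pair c c := h1 ▸ mem_pair.2 (Or.inl rfl)
      simpa using this
    · have : c ∈ᵤ pair a a := h1 ▸ mem_pair.2 (Or.inl rfl)
      exact ((mem_pair.1 this).elim id id).symm
  subst hac
  exact ⟨rfl, pair_inj (pair_inj h)⟩

theorem maps_iff {f a b : M} : Maps f a b ↔ opair a b ∈ᵤ f := by
  simp [Maps, isOrdPair_iff]

/-- The union of the members of `x`. -/
noncomputable def sUnion (x : M) : M := coll fun z => ∃ w, w ∈ᵤ x ∧ z ∈ᵤ w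

instance {a : (ι → M) → M} [DefTerm a] : DefTerm fun v => sUnion (a v) := by
  unfold sUnion; infer_instance

@[simp] theorem mem_sUnion {x z : M} : z ∈ᵤ sUnion x ↔ ∃ w, w ∈ᵤ x ∧ z ∈ᵤ w :=
  mem_coll (hM.1.union x)

theorem isSet_sUnion (x : M) : IsSet (sUnion x) := isSet_coll (hM.1.union x)

/-- The union of two objects. -/
noncomputable def union (x y : M) : M := sUnion (pair x y)

instance {a b : (ι → M) → M} [DefTerm a] [DefTerm b] : DefTerm fun v => union (a v) (b v) := by
  unfold union; infer_instance

@[simp] theorem mem_union {x y z : M} : z ∈ᵤ union x y ↔ z ∈ᵤ x ∨ z ∈ᵤ y := by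
  simp [union]

theorem isSet_union (x y : M) : IsSet (union x y) := isSet_sUnion _

/-- The empty set. -/
noncomputable def empty (M : Type u) [lang.Structure M] [Fact (ModelsZFUR M)] : M :=
  coll fun _ => False

theorem small_false : Small fun _ : M => False :=
  small_of_sub (x := Classical.arbitrary M) fun _ h => h.elim

@[simp] theorem not_mem_empty {z : M} : ¬ z ∈ᵤ empty M := (mem_coll small_false).not.2 id

theorem isEmptySet_iff {x : M} : IsEmptySet x ↔ x = empty M := by
  rw [empty, eq_coll small_false]
  simp [IsEmptySet]

/-- The successor `x ∪ {x}`. -/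
noncomputable def succ (x : M) : M := union x (pair x x)

instance {a : (ι → M) → M} [DefTerm a] : DefTerm fun v => succ (a v) := by
  unfold succ; infer_instance

@[simp] theorem mem_succ {x z : M} : z ∈ᵤ succ x ↔ z ∈ᵤ x ∨ z = x := by
  simp [succ]

theorem isSucc_iff {s x : M} : IsSucc s x ↔ s = succ x := by
  constructor
  · rintro ⟨hs, h⟩
    exact ext_set hs (isSet_union _ _) fun z => by rw [h, mem_succ]
  · rintro rfl
    exact ⟨isSet_union _ _, fun z => mem_succ⟩

theorem succ_ne_empty (x : M) : succ x ≠ empty M := fun h =>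
  not_mem_empty (h ▸ mem_succ.2 (Or.inr rfl) : x ∈ᵤ empty M)

theorem not_mem_cycle {x y : M} (hxy : x ∈ᵤ y) : ¬ y ∈ᵤ x := by
  intro hyx
  obtain ⟨z, hz, h⟩ := hM.1.foundation (pair x y) ⟨x, by simp⟩
  rcases mem_pair.1 hz with rfl | rfl
  · exact h y (by simp) hyx
  · exact h x (by simp) hxy

theorem not_mem_self (x : M) : ¬ x ∈ᵤ x := fun h => not_mem_cycle h h

theorem succ_inj {x y : M} (h : succ x = succ y) : x = y := by
  have hx : x ∈ᵤ succ y := h ▸ mem_succ.2 (Or.inr rfl)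
  have hy : y ∈ᵤ succ x := h ▸ mem_succ.2 (Or.inr rfl)
  rw [mem_succ] at hx hy
  rcases hx with hx | rfl
  · rcases hy with hy | rfl
    · exact (not_mem_cycle hx hy).elim
    · rfl
  · rfl

/-- The set of ordered pairs with first component in `x` and second component in `y`. -/
noncomputable def prod (x y : M) : M := coll fun p => ∃ a, a ∈ᵤ x ∧ ∃ b, b ∈ᵤ y ∧ p = opair a b

theorem small_prod (x y : M) : Small fun p => ∃ a, a ∈ᵤ x ∧ ∃ b, b ∈ᵤ y ∧ p = opair a b := by
  obtain ⟨s, hs, h⟩ := small_biUnion x fun a => coll fun p => ∃ b, b ∈ᵤ y ∧ p = opair a b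
  refine ⟨s, hs, fun z => (h z).trans ?_⟩
  simp only [mem_coll (small_image y _)]

theorem mem_prod {x y p : M} :
    p ∈ᵤ prod x y ↔ ∃ a, a ∈ᵤ x ∧ ∃ b, b ∈ᵤ y ∧ p = opair a b :=
  mem_coll (small_prod x y)

theorem isSet_prod (x y : M) : IsSet (prod x y) := isSet_coll (small_prod x y)

end BasicSets

/-! ### Natural numbers, transitive closure, and recursion on membership. -/

section Recursion

variable {M : Type u} [lang.Structure M] [hM : Fact (ModelsZFUR M)] {ι : Type}

/-- A set containing the empty set and closed under successors. -/
def Inductive (w : M) : Prop := empty M ∈ᵤ w ∧ ∀ x, x ∈ᵤ w → succ x ∈ᵤ w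

instance {a : (ι → M) → M} [DefTerm a] : DefPred fun v => Inductive (a v) := by
  unfold Inductive; infer_instance

/-- The set of natural numbers. -/
noncomputable def omega (M : Type u) [lang.Structure M] [Fact (ModelsZFUR M)] : M :=
  coll fun n => ∀ w, Inductive w → n ∈ᵤ w

theorem mem_omega {n : M} : n ∈ᵤ omega M ↔ ∀ w, Inductive w → n ∈ᵤ w := by
  refine mem_coll ?_
  obtain ⟨w, -, ⟨e, he, hew⟩, hs⟩ := hM.1.infinity
  refine small_of_sub (x := w) fun n hn => hn w ⟨isEmptySet_iff.1 he ▸ hew, fun x hx => ?_⟩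
  obtain ⟨s, hs, hsw⟩ := hs x hx
  exact isSucc_iff.1 hs ▸ hsw

theorem inductive_omega : Inductive (omega M) :=
  ⟨mem_omega.2 fun _ h => h.1, fun _ hx => mem_omega.2 fun w h => h.2 _ (mem_omega.1 hx w h)⟩

theorem omega_induction {P : M → Prop} [hP : DefSet P] (h0 : P (empty M))
    (hs : ∀ n, P n → P (succ n)) {n : M} (hn : n ∈ᵤ omega M) : P n := by
  have hsm := small_sep (omega M) P
  refine ((mem_coll hsm).1 (mem_omega.1 hn _ ⟨?_, fun x hx => ?_⟩)).2
  · exact (mem_coll hsm).2 ⟨inductive_omega.1, h0⟩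
  · rw [mem_coll hsm] at hx ⊢
    exact ⟨inductive_omega.2 _ hx.1, hs _ hx.2⟩

/-- Closure of a point under a definable class function. -/
theorem exists_closed_set (G : M → M) [hG : DefFun G] (a : M) :
    ∃ C : M, a ∈ᵤ C ∧ ∀ z, z ∈ᵤ C → G z ∈ᵤ C := by
  have inst {ι : Type} (t : (ι → M) → M) [DefTerm t] : DefTerm fun v => G (t v) := hG.comp t
  -- Partial computations: sets of pairs in which every pair is justified by another one. They need
  -- not be functions; uniqueness of the computed value comes afterwards, by induction on `n`.
  let D : M → Prop := fun p => ∀ n y, opair n y ∈ᵤ p →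
    (n = empty M ∧ y = a) ∨ ∃ k w, opair k w ∈ᵤ p ∧ n = succ k ∧ y = G w
  have hDd {ι : Type} (t : (ι → M) → M) [DefTerm t] : DefPred fun v => D (t v) := by
    unfold D; infer_instance
  let R : M → M → Prop := fun n y => ∃ p, D p ∧ opair n y ∈ᵤ p
  have hRd {ι : Type} (s t : (ι → M) → M) [DefTerm s] [DefTerm t] :
      DefPred fun v => R (s v) (t v) := by
    unfold R; infer_instance
  have hR0 : ∀ y, R (empty M) y ↔ y = a := by
    intro y
    constructor
    · rintro ⟨p, hp, hy⟩
      rcases hp _ _ hy with h | ⟨k, w, -, h, -⟩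
      · exact h.2
      · exact (succ_ne_empty k h.symm).elim
    · rintro rfl
      refine ⟨pair (opair (empty M) y) (opair (empty M) y), fun n z h => ?_, by simp⟩
      simp only [mem_pair, opair_inj, or_self] at h
      exact Or.inl h
  have hRs : ∀ n y, R (succ n) y ↔ ∃ w, R n w ∧ y = G w := by
    intro n y
    constructor
    · rintro ⟨p, hp, hy⟩
      rcases hp _ _ hy with h | ⟨k, w, hw, h, h'⟩
      · exact (succ_ne_empty n h.1).elim
      · obtain rfl := succ_inj h
        exact ⟨w, ⟨p, hp, hw⟩, h'⟩
    · rintro ⟨w, ⟨p, hp, hw⟩, rfl⟩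
      refine ⟨union p (pair (opair (succ n) (G w)) (opair (succ n) (G w))),
        fun m z h => ?_, by simp⟩
      simp only [mem_union, mem_pair, opair_inj, or_self] at h ⊢
      rcases h with h | ⟨rfl, rfl⟩
      · exact (hp _ _ h).imp id fun ⟨k, w, hk, h⟩ => ⟨k, w, Or.inl hk, h⟩
      · exact Or.inr ⟨n, w, Or.inl hw, rfl, rfl⟩
  have huniq : ∀ n, n ∈ᵤ omega M → ∃! y, R n y := by
    intro n hn
    refine omega_induction (P := fun n => ∃! y, R n y) ?_ ?_ hn
    · exact ⟨a, (hR0 a).2 rfl, fun y => (hR0 y).1⟩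
    · rintro n ⟨y, hy, hu⟩
      refine ⟨G y, (hRs _ _).2 ⟨y, hy, rfl⟩, fun z hz => ?_⟩
      obtain ⟨w, hw, rfl⟩ := (hRs _ _).1 hz
      rw [hu w hw]
  have hC := small_image_rel huniq
  refine ⟨coll _, (mem_coll hC).2 ⟨_, inductive_omega.1, (hR0 a).2 rfl⟩, fun z hz => ?_⟩
  rw [mem_coll hC] at hz ⊢
  obtain ⟨n, hn, hz⟩ := hz
  exact ⟨succ n, inductive_omega.2 n hn, (hRs _ _).2 ⟨z, hz, rfl⟩⟩

theorem exists_isTrans_mem (x : M) : ∃ t : M, IsTrans t ∧ x ∈ᵤ t := by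
  obtain ⟨C, hx, hC⟩ := exists_closed_set (M := M) (fun z => sUnion z) (pair x x)
  refine ⟨sUnion C, ⟨isSet_sUnion C, fun y z hy hz => ?_⟩, mem_sUnion.2 ⟨_, hx, by simp⟩⟩
  obtain ⟨w, hw, hyw⟩ := mem_sUnion.1 hy
  exact mem_sUnion.2 ⟨_, hC w hw, mem_sUnion.2 ⟨y, hyw, hz⟩⟩

/-- Foundation for definable classes: cutting the class down to a transitive set around `x` loses no
members of the minimal element found there. -/
theorem exists_minimal {P : M → Prop} [hP : DefSet P] {x : M} (hx : P x) :
    ∃ y, P y ∧ ∀ z, z ∈ᵤ y → ¬ P z := by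
  obtain ⟨t, ht, hxt⟩ := exists_isTrans_mem x
  have hs := small_sep t P
  obtain ⟨y, hy, hmin⟩ := hM.1.foundation _ ⟨x, (mem_coll hs).2 ⟨hxt, hx⟩⟩
  rw [mem_coll hs] at hy
  exact ⟨y, hy.2, fun z hz hPz => hmin z ((mem_coll hs).2 ⟨ht.2 y z hy.1 hz, hPz⟩) hz⟩

theorem mem_induction {P : M → Prop} [hP : DefSet P] (h : ∀ y, (∀ z, z ∈ᵤ y → P z) → P y)
    (x : M) : P x := by
  have inst {ι : Type} (t : (ι → M) → M) [DefTerm t] : DefPred fun v => P (t v) := hP.comp t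
  by_contra hx
  obtain ⟨y, hy, hmin⟩ := exists_minimal (P := fun x => ¬ P x) hx
  exact hy (h y fun z hz => not_not.1 (hmin z hz))

/-- Recursion on membership, with a parameter. -/
theorem exists_mem_recursion (H : M → M → M → M)
    (hH : ∀ {ι : Type} (r s t : (ι → M) → M) [DefTerm r] [DefTerm s] [DefTerm t],
      DefTerm fun v => H (r v) (s v) (t v)) :
    ∃ F : M → M → M, DefFun₂ F ∧
      ∀ b y, F b y = H b y (coll fun w => ∃ z, z ∈ᵤ y ∧ w = F b z) := by
  -- Partial computations again: a pair ⟨y, v⟩ is justified by a set `i` consisting of values that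
  -- `p` records for the members of `y`, with every member represented.
  let D : M → M → Prop := fun b p => ∀ y v, opair y v ∈ᵤ p → ∃ i, IsSet i ∧ v = H b y i ∧
    (∀ z, z ∈ᵤ y → ∃ w, w ∈ᵤ i ∧ opair z w ∈ᵤ p) ∧
    (∀ w, w ∈ᵤ i → ∃ z, z ∈ᵤ y ∧ opair z w ∈ᵤ p)
  have hDd {ι : Type} (s t : (ι → M) → M) [DefTerm s] [DefTerm t] :
      DefPred fun v => D (s v) (t v) := by
    unfold D; infer_instance
  let R : M → M → M → Prop := fun b n y => ∃ p, D b p ∧ opair n y ∈ᵤ p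
  have hRd {ι : Type} (r s t : (ι → M) → M) [DefTerm r] [DefTerm s] [DefTerm t] :
      DefPred fun v => R (r v) (s v) (t v) := by
    unfold R; infer_instance
  have hRR : ∀ b y v, R b y v → ∃ i, IsSet i ∧ v = H b y i ∧
      (∀ z, z ∈ᵤ y → ∃ w, w ∈ᵤ i ∧ R b z w) ∧ (∀ w, w ∈ᵤ i → ∃ z, z ∈ᵤ y ∧ R b z w) := by
    rintro b y v ⟨p, hp, hyv⟩
    obtain ⟨i, hi, hv, h1, h2⟩ := hp y v hyv
    refine ⟨i, hi, hv, fun z hz => ?_, fun w hw => ?_⟩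
    · obtain ⟨w, hw, hzw⟩ := h1 z hz
      exact ⟨w, hw, p, hp, hzw⟩
    · obtain ⟨z, hz, hzw⟩ := h2 w hw
      exact ⟨z, hz, p, hp, hzw⟩
  have huniq : ∀ b y v v', R b y v → R b y v' → v = v' := by
    intro b
    refine mem_induction fun y ih v v' hv hv' => ?_
    obtain ⟨i, hi, rfl, h1, h2⟩ := hRR b y v hv
    obtain ⟨i', hi', rfl, h1', h2'⟩ := hRR b y v' hv'
    congr 1
    refine ext_set hi hi' fun w => ⟨fun hw => ?_, fun hw => ?_⟩
    · obtain ⟨z, hz, hzw⟩ := h2 w hw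
      obtain ⟨w', hw', hzw'⟩ := h1' z hz
      exact ih z hz w w' hzw hzw' ▸ hw'
    · obtain ⟨z, hz, hzw⟩ := h2' w hw
      obtain ⟨w', hw', hzw'⟩ := h1 z hz
      exact ih z hz w w' hzw hzw' ▸ hw'
  have hex : ∀ b y, ∃ v, R b y v := by
    intro b
    refine mem_induction fun y ih => ?_
    have hi := small_image_rel (w := y) (R := R b) fun z hz =>
      (ih z hz).imp fun w hw => ⟨hw, fun w' hw' => huniq b z _ _ hw' hw⟩
    obtain ⟨t, ht, hyt⟩ := exists_isTrans_mem y
    -- No computation is chosen for each member of `y`, as that would need Choice. All computed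
    -- values on a transitive set around `y` are taken together, and they form a computation.
    have hq1 := small_sep t fun a => ∃ c, R b a c
    have hq : Small fun p => ∃ a, a ∈ᵤ t ∧ ∃ c, R b a c ∧ p = opair a c := by
      obtain ⟨q, hqs, hq⟩ := small_image_rel (w := coll fun a => a ∈ᵤ t ∧ ∃ c, R b a c)
        (R := fun a p => ∃ c, R b a c ∧ p = opair a c) (by
          intro a ha
          obtain ⟨-, c, hc⟩ := (mem_coll hq1).1 ha
          refine ⟨opair a c, ⟨c, hc, rfl⟩, ?_⟩
          rintro _ ⟨c', hc', rfl⟩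
          rw [huniq b a c' c hc' hc])
      refine ⟨q, hqs, fun p => (hq p).trans ?_⟩
      simp only [mem_coll hq1]
      exact ⟨fun ⟨a, h, h'⟩ => ⟨a, h.1, h'⟩,
        fun ⟨a, h, b, h'⟩ => ⟨a, ⟨h, b, h'.1⟩, b, h'⟩⟩
    have hmq : ∀ a c, opair a c ∈ᵤ coll (fun p => ∃ a, a ∈ᵤ t ∧ ∃ c, R b a c ∧ p = opair a c) ↔
        a ∈ᵤ t ∧ R b a c := by
      intro a c
      rw [mem_coll hq]
      constructor
      · rintro ⟨a', ha', b', hb', h⟩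
        obtain ⟨rfl, rfl⟩ := opair_inj.1 h
        exact ⟨ha', hb'⟩
      · exact fun h => ⟨a, h.1, c, h.2, rfl⟩
    generalize hqe : coll (fun p => ∃ a, a ∈ᵤ t ∧ ∃ c, R b a c ∧ p = opair a c) = q at hmq
    generalize hie : coll (fun w => ∃ z, z ∈ᵤ y ∧ R b z w) = i
    have hmi : ∀ w, w ∈ᵤ i ↔ ∃ z, z ∈ᵤ y ∧ R b z w := fun w => hie ▸ mem_coll hi
    refine ⟨H b y i, union q (pair (opair y (H b y i)) (opair y (H b y i))), ?_, by simp⟩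
    intro a c hab
    simp only [mem_union, mem_pair, opair_inj, or_self, hmq] at hab ⊢
    rcases hab with ⟨ha, hab⟩ | ⟨rfl, rfl⟩
    · obtain ⟨j, hj, hb, h1, h2⟩ := hRR b a c hab
      refine ⟨j, hj, hb, fun z hz => ?_, fun w hw => ?_⟩
      · obtain ⟨w, hw, hzw⟩ := h1 z hz
        exact ⟨w, hw, Or.inl ⟨ht.2 a z ha hz, hzw⟩⟩
      · obtain ⟨z, hz, hzw⟩ := h2 w hw
        exact ⟨z, hz, Or.inl ⟨ht.2 a z ha hz, hzw⟩⟩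
    · refine ⟨i, hie ▸ isSet_coll hi, rfl, fun z hz => ?_, fun w hw => ?_⟩
      · obtain ⟨w, hw⟩ := ih z hz
        exact ⟨w, (hmi w).2 ⟨z, hz, hw⟩, Or.inl ⟨ht.2 _ z hyt hz, hw⟩⟩
      · obtain ⟨z, hz, hzw⟩ := (hmi w).1 hw
        exact ⟨z, hz, Or.inl ⟨ht.2 _ z hyt hz, hzw⟩⟩
  choose F hF using hex
  have hFd : DefFun₂ F := ⟨DefTerm.of_graph (P := fun v y => R (v false) (v true) y) inferInstance
    fun v y => ⟨fun h => h ▸ hF _ _, fun h => huniq _ _ _ _ h (hF _ _)⟩⟩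
  refine ⟨F, hFd, fun b y => ?_⟩
  have hFb : DefFun (F b) := ⟨hFd.comp (fun _ => b) fun v => v ()⟩
  obtain ⟨i, hi, hv, h1, h2⟩ := hRR b y _ (hF b y)
  rw [hv]
  congr 1
  refine (eq_coll (small_image y (F b))).2 ⟨hi, fun w => ⟨fun hw => ?_, ?_⟩⟩
  · obtain ⟨z, hz, hzw⟩ := h2 w hw
    exact ⟨z, hz, huniq b z _ _ hzw (hF b z)⟩
  · rintro ⟨z, hz, rfl⟩
    obtain ⟨w, hw, hzw⟩ := h1 z hz
    exact huniq b z _ _ hzw (hF b z) ▸ hw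

end Recursion

/-! ### Set-sized injections and bijections as definable class functions. -/

section Injections

variable {M : Type u} [lang.Structure M]

theorem InjectsInto.mono {x : M} {C D : M → Prop} (h : InjectsInto x C)
    (hCD : ∀ z, C z → D z) : InjectsInto x D := by
  obtain ⟨f, hf, hC⟩ := h
  exact ⟨f, hf, fun a b hab => hCD _ (hC a b hab)⟩

variable [hM : Fact (ModelsZFUR M)]

/-- Replaces a function coded as a set by a total class function, so that composites are ordinary
composites and Replacement applies to them. -/
theorem exists_defFun_maps {f : M} (hf : ∀ a b c, Maps f a b → Maps f a c → b = c) :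
    ∃ g : M → M, DefFun g ∧ ∀ a, (∃ b, Maps f a b) → Maps f a (g a) := by
  classical
  refine ⟨fun a => if h : ∃ b, Maps f a b then h.choose else empty M, ?_, fun a h => ?_⟩
  · refine ⟨DefTerm.of_graph (P := fun v y => Maps f (v ()) y ∨
      (¬ ∃ b, Maps f (v ()) b) ∧ y = empty M) inferInstance fun v y => ?_⟩
    by_cases h : ∃ b, Maps f (v ()) b
    · simp only [h, dite_true, not_true_eq_false, false_and, or_false]
      exact ⟨fun e => e ▸ h.choose_spec, fun e => hf _ _ _ e h.choose_spec⟩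
    · simp only [h, dite_false, not_false_eq_true, true_and]
      exact ⟨Or.inr, fun e => e.elim (fun e => (h ⟨y, e⟩).elim) id⟩
  · simp only [h, dite_true]
    exact h.choose_spec

/-- The graph of the restriction of `g` to `x`. -/
noncomputable def graphOn (g : M → M) (x : M) : M :=
  coll fun p => ∃ a, a ∈ᵤ x ∧ p = opair a (g a)

theorem maps_graphOn {g : M → M} [hg : DefFun g] {x a b : M} :
    Maps (graphOn g x) a b ↔ a ∈ᵤ x ∧ b = g a := by
  have inst {ι : Type} (t : (ι → M) → M) [DefTerm t] : DefTerm fun v => g (t v) := hg.comp t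
  rw [maps_iff, graphOn, mem_coll (small_image x fun a => opair a (g a))]
  constructor
  · rintro ⟨c, hc, h⟩
    obtain ⟨rfl, rfl⟩ := opair_inj.1 h
    exact ⟨hc, rfl⟩
  · rintro ⟨ha, rfl⟩
    exact ⟨a, ha, rfl⟩

theorem isInjOn_graphOn {g : M → M} [hg : DefFun g] {x : M}
    (hinj : ∀ a b, a ∈ᵤ x → b ∈ᵤ x → g a = g b → a = b) : IsInjOn (graphOn g x) x := by
  have inst {ι : Type} (t : (ι → M) → M) [DefTerm t] : DefTerm fun v => g (t v) := hg.comp t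
  have hs := small_image x fun a => opair a (g a)
  refine ⟨⟨isSet_coll hs, fun p hp => ?_, ?_, ?_⟩, ?_⟩
  · obtain ⟨a, -, rfl⟩ := (mem_coll hs).1 hp
    exact ⟨a, g a, isOrdPair_iff.2 rfl⟩
  · simp only [maps_graphOn]
    rintro a b c ⟨-, rfl⟩ ⟨-, rfl⟩
    rfl
  · simp only [maps_graphOn]
    exact fun a => ⟨fun h => ⟨_, h, rfl⟩, fun ⟨_, h, _⟩ => h⟩
  · simp only [maps_graphOn]
    rintro a b c ⟨ha, rfl⟩ ⟨hb, h⟩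
    exact hinj a b ha hb h

theorem injectsInto_iff {x : M} {C : M → Prop} :
    InjectsInto x C ↔ ∃ g : M → M, DefFun g ∧
      (∀ a b, a ∈ᵤ x → b ∈ᵤ x → g a = g b → a = b) ∧ ∀ a, a ∈ᵤ x → C (g a) := by
  constructor
  · rintro ⟨f, ⟨⟨-, -, hfun, hdom⟩, hinj⟩, hC⟩
    obtain ⟨g, hg, hfg⟩ := exists_defFun_maps hfun
    refine ⟨g, hg, fun a b ha hb hab => ?_, fun a ha => hC a _ (hfg a ((hdom a).1 ha))⟩
    exact hinj a b (g a) (hfg a ((hdom a).1 ha)) (hab ▸ hfg b ((hdom b).1 hb))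
  · rintro ⟨g, hg, hinj, hC⟩
    refine ⟨graphOn g x, isInjOn_graphOn hinj, fun a b hab => ?_⟩
    obtain ⟨ha, rfl⟩ := maps_graphOn.1 hab
    exact hC a ha

/-- A set-sized bijection given by a pair of mutually inverse definable class functions. -/
theorem Equinumerous.exists_defFun {x y : M} (h : Equinumerous x y) :
    ∃ g k : M → M, DefFun g ∧ DefFun k ∧ (∀ a, a ∈ᵤ x → g a ∈ᵤ y ∧ k (g a) = a) ∧
      ∀ b, b ∈ᵤ y → k b ∈ᵤ x ∧ g (k b) = b := by
  obtain ⟨f, ⟨⟨-, -, hfun, hdom⟩, hinj⟩, hran⟩ := h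
  obtain ⟨g, hg, hfg⟩ := exists_defFun_maps hfun
  have inst {ι : Type} (t : (ι → M) → M) [DefTerm t] : DefTerm fun v => g (t v) := hg.comp t
  have hgi : ∀ a b, a ∈ᵤ x → b ∈ᵤ x → g a = g b → a = b := fun a b ha hb hab =>
    hinj a b (g a) (hfg a ((hdom a).1 ha)) (hab ▸ hfg b ((hdom b).1 hb))
  have hk : ∀ b, ∃ a, b ∈ᵤ y ∧ a ∈ᵤ x ∧ g a = b ∨ ¬ b ∈ᵤ y ∧ a = empty M := by
    intro b
    by_cases hb : b ∈ᵤ y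
    · obtain ⟨a, ha⟩ := (hran b).1 hb
      have hax := (hdom a).2 ⟨b, ha⟩
      exact ⟨a, Or.inl ⟨hb, hax, hfun a _ _ (hfg a ⟨b, ha⟩) ha⟩⟩
    · exact ⟨_, Or.inr ⟨hb, rfl⟩⟩
  choose k hk using hk
  refine ⟨g, k, hg, ⟨DefTerm.of_graph (P := fun v a => v () ∈ᵤ y ∧ a ∈ᵤ x ∧ g a = v () ∨
    ¬ v () ∈ᵤ y ∧ a = empty M) inferInstance fun v a => ⟨fun h => h ▸ hk _, fun h => ?_⟩⟩,
    fun a ha => ?_, fun b hb => ?_⟩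
  · rcases h with ⟨h1, h2, h3⟩ | ⟨h1, h2⟩ <;> rcases hk (v ()) with ⟨h1', h2', h3'⟩ | ⟨h1', h2'⟩
    · exact hgi _ _ h2 h2' (h3.trans h3'.symm)
    · exact (h1' h1).elim
    · exact (h1 h1').elim
    · exact h2.trans h2'.symm
  · have hgy := (hran (g a)).2 ⟨a, hfg a ((hdom a).1 ha)⟩
    rcases hk (g a) with h | h
    · exact ⟨hgy, hgi _ _ h.2.1 ha h.2.2⟩
    · exact (h.1 hgy).elim
  · rcases hk b with h | h
    · exact h.2
    · exact (h.1 hb).elim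

end Injections

/-! ### Kernels and the cumulative hierarchy over a set of urelements. -/

section Hierarchy

variable {M : Type u} [lang.Structure M] {ι : Type}

theorem inTC_self (x : M) : InTC x x := fun _ _ h => h

theorem InTC.trans {x y z : M} (hxy : InTC x y) (hyz : InTC y z) : InTC x z :=
  fun t ht hz => hxy t ht (hyz t ht hz)

theorem inTC_of_mem {x y : M} (h : x ∈ᵤ y) : InTC x y := fun _ ht hy => ht.2 y x hy h

/-- The kernel of `z` is contained in `B`. -/
def KernelIn (B z : M) : Prop := ∀ u, InTC u z → IsUr u → u ∈ᵤ B

instance {a b : (ι → M) → M} [DefTerm a] [DefTerm b] :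
    DefPred fun v => KernelIn (a v) (b v) := by
  unfold KernelIn; infer_instance

theorem KernelIn.mem {B z w : M} (h : KernelIn B z) (hw : w ∈ᵤ z) : KernelIn B w :=
  fun u hu => h u (hu.trans (inTC_of_mem hw))

theorem KernelIn.mono {B C z : M} (h : KernelIn B z) (hBC : Sub B C) : KernelIn C z :=
  fun u hu hur => hBC u (h u hu hur)

/-- Members of an ordinal are ordinals. -/
theorem IsOrd.of_mem {α β : M} (hα : IsOrd α) (hβ : β ∈ᵤ α) : IsOrd β := by
  obtain ⟨ht, hp, hirr, htr, htot, hmin⟩ := hα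
  have hsub : Sub β α := fun z hz => ht.2 β z hβ hz
  have hpβ : IsPure β := fun y hy => hp y (hy.trans (inTC_of_mem hβ))
  refine ⟨⟨hpβ β (inTC_self β), fun x y hx hy => ?_⟩, hpβ, fun a ha => hirr a (hsub a ha),
    fun a b c ha hb hc => htr a b c (hsub a ha) (hsub b hb) (hsub c hc),
    fun a b ha hb => htot a b (hsub a ha) (hsub b hb),
    fun s hs => hmin s fun z hz => hsub z (hs z hz)⟩
  exact htr y x β (ht.2 x y (hsub x hx) hy) (hsub x hx) hβ hy hx

variable [hM : Fact (ModelsZFUR M)]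

/-- The objects satisfying the right-hand side inside a transitive set around `z` themselves form a
transitive set containing `z`. -/
theorem InTC.eq_or_mem {u z : M} (h : InTC u z) : u = z ∨ ∃ w, w ∈ᵤ z ∧ InTC u w := by
  obtain ⟨t, ht, hz⟩ := exists_isTrans_mem z
  have hs := small_sep t fun u => u = z ∨ ∃ w, w ∈ᵤ z ∧ InTC u w
  refine ((mem_coll hs).1 (h _ ⟨isSet_coll hs, fun x y hx hy => ?_⟩
    ((mem_coll hs).2 ⟨hz, Or.inl rfl⟩))).2
  rw [mem_coll hs] at hx ⊢
  refine ⟨ht.2 x y hx.1 hy, Or.inr ?_⟩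
  rcases hx.2 with rfl | ⟨w, hw, hxw⟩
  · exact ⟨y, hy, inTC_self y⟩
  · exact ⟨w, hw, (inTC_of_mem hy).trans hxw⟩

theorem KernelIn.of_isSet {B z : M} (hz : IsSet z) (h : ∀ w, w ∈ᵤ z → KernelIn B w) :
    KernelIn B z := by
  intro u hu hur
  rcases hu.eq_or_mem with rfl | ⟨w, hw, huw⟩
  · exact (hz hur).elim
  · exact h w hw u huw hur

theorem KernelIn.of_mem {B u : M} (hB : IsUrSet B) (hu : u ∈ᵤ B) : KernelIn B u := by
  intro x hx _
  rcases hx.eq_or_mem with rfl | ⟨w, hw, -⟩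
  · exact hu
  · exact (isSet_of_mem hw (hB.2 u hu)).elim

theorem small_nextStage (B i : M) :
    Small fun z => z ∈ᵤ B ∨ IsSet z ∧ ∃ w, w ∈ᵤ i ∧ IsSet w ∧ Sub z w := by
  have hw : ∀ w : M, Small fun z => IsSet w ∧ IsSet z ∧ Sub z w := by
    intro w
    by_cases h : IsSet w
    · simpa [h] using small_pow h
    · simpa [h] using small_false
  have hs := small_biUnion i fun w => coll fun z => IsSet w ∧ IsSet z ∧ Sub z w
  refine small_of_sub (x := union B (coll fun z => ∃ x, x ∈ᵤ i ∧
    z ∈ᵤ coll fun z => IsSet x ∧ IsSet z ∧ Sub z x)) fun z hz => ?_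
  rw [mem_union, mem_coll hs]
  rcases hz with hz | ⟨hz, w, hwi, h⟩
  · exact Or.inl hz
  · exact Or.inr ⟨w, hwi, (mem_coll (hw w)).2 ⟨h.1, hz, h.2⟩⟩

theorem exists_stage : ∃ F : M → M → M, DefFun₂ F ∧
    ∀ B d, F B d = coll fun z => z ∈ᵤ B ∨ IsSet z ∧ ∃ w,
      w ∈ᵤ (coll fun w => ∃ e, e ∈ᵤ d ∧ w = F B e) ∧ IsSet w ∧ Sub z w :=
  exists_mem_recursion (fun B _ i => coll fun z =>
    z ∈ᵤ B ∨ IsSet z ∧ ∃ w, w ∈ᵤ i ∧ IsSet w ∧ Sub z w) fun _ _ _ => inferInstance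

/-- The cumulative hierarchy over `B`, indexed by arbitrary sets. -/
noncomputable def stage (B d : M) : M := exists_stage.choose B d

instance {a b : (ι → M) → M} [DefTerm a] [DefTerm b] : DefTerm fun v => stage (a v) (b v) :=
  (exists_stage (M := M)).choose_spec.1.comp a b

theorem isSet_stage (B d : M) : IsSet (stage B d) := by
  rw [stage, exists_stage.choose_spec.2 B d]
  exact isSet_coll (small_nextStage _ _)

/-- One clause covers the zero, successor and limit steps, since the recursion runs along membership
in an arbitrary index; no theory of ordinals is needed. -/
theorem mem_stage {B d z : M} :
    z ∈ᵤ stage B d ↔ z ∈ᵤ B ∨ IsSet z ∧ ∃ e, e ∈ᵤ d ∧ Sub z (stage B e) := by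
  have hs := small_image d fun e => stage B e
  have h := exists_stage.choose_spec.2 B d
  change stage B d = coll fun z => z ∈ᵤ B ∨ IsSet z ∧ ∃ w,
      w ∈ᵤ (coll fun w => ∃ e, e ∈ᵤ d ∧ w = stage B e) ∧ IsSet w ∧ Sub z w at h
  rw [h, mem_coll (small_nextStage _ _)]
  simp only [mem_coll hs]
  constructor
  · rintro (h | ⟨hz, _, ⟨e, he, rfl⟩, -, h⟩)
    · exact Or.inl h
    · exact Or.inr ⟨hz, e, he, h⟩
  · rintro (h | ⟨hz, e, he, h⟩)
    · exact Or.inl h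
    · exact Or.inr ⟨hz, _, ⟨e, he, rfl⟩, isSet_stage _ _, h⟩

theorem stage_mono_left {B C : M} (h : Sub B C) (d : M) : Sub (stage B d) (stage C d) := by
  refine mem_induction (P := fun d => Sub (stage B d) (stage C d)) (fun d ih z hz => ?_) d
  rw [mem_stage] at hz ⊢
  refine hz.imp (h z) fun ⟨hz, e, he, hze⟩ => ⟨hz, e, he, fun w hw => ih e he w (hze w hw)⟩

theorem stage_mono_right (B : M) {d e : M} (h : Sub d e) : Sub (stage B d) (stage B e) := by
  intro z hz
  rw [mem_stage] at hz ⊢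
  exact hz.imp id fun ⟨hz, c, hc, hzc⟩ => ⟨hz, c, h c hc, hzc⟩

theorem isTrans_stage {B : M} (hB : IsUrSet B) (d : M) : IsTrans (stage B d) := by
  refine mem_induction (P := fun d => IsTrans (stage B d)) (fun d ih => ?_) d
  refine ⟨isSet_stage _ _, fun x y hx hy => ?_⟩
  rcases mem_stage.1 hx with hx | ⟨-, e, he, hx⟩
  · exact (isSet_of_mem hy (hB.2 x hx)).elim
  · have hye := hx y hy
    rw [mem_stage]
    by_cases hys : IsSet y
    · exact Or.inr ⟨hys, e, he, fun w hw => (ih e he).2 y w hye hw⟩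
    · rcases mem_stage.1 hye with h | h
      · exact Or.inl h
      · exact (hys h.1).elim

theorem KernelIn.of_mem_stage {B d z : M} (hB : IsUrSet B) (hz : z ∈ᵤ stage B d) :
    KernelIn B z := by
  refine mem_induction (P := fun d => ∀ z, z ∈ᵤ stage B d → KernelIn B z)
    (fun d ih z hz => ?_) d z hz
  rcases mem_stage.1 hz with hz | ⟨hzs, e, he, hz⟩
  · exact .of_mem hB hz
  · exact .of_isSet hzs fun w hw => ih e he w (hz w hw)

theorem kernelIn_stage {B : M} (hB : IsUrSet B) (d : M) : KernelIn B (stage B d) :=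
  .of_isSet (isSet_stage B d) fun _ => .of_mem_stage hB

theorem exists_rank : ∃ F : M → M → M, DefFun₂ F ∧
    ∀ b y, F b y = coll fun w => ∃ z, z ∈ᵤ y ∧ w = F b z :=
  exists_mem_recursion (fun _ _ i => i) fun _ _ _ => inferInstance

/-- The pure set obtained by hereditarily replacing urelements with the empty set. -/
noncomputable def rank (y : M) : M := exists_rank.choose (empty M) y

instance {a : (ι → M) → M} [DefTerm a] : DefTerm fun v => rank (a v) :=
  (exists_rank (M := M)).choose_spec.1.comp (fun _ => empty M) a

theorem rank_eq (y : M) : rank y = coll fun w => ∃ z, z ∈ᵤ y ∧ w = rank z :=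
  exists_rank.choose_spec.2 (empty M) y

theorem isSet_rank (y : M) : IsSet (rank y) := by
  rw [rank_eq]
  exact isSet_coll (small_image y rank)

theorem mem_rank {y w : M} : w ∈ᵤ rank y ↔ ∃ z, z ∈ᵤ y ∧ w = rank z := by
  rw [rank_eq, mem_coll (small_image y rank)]

theorem kernelIn_rank (B y : M) : KernelIn B (rank y) := by
  refine mem_induction (P := fun y => KernelIn B (rank y)) (fun y ih => ?_) y
  refine .of_isSet (isSet_rank y) fun w hw => ?_
  obtain ⟨z, hz, rfl⟩ := mem_rank.1 hw
  exact ih z hz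

/-- A set with kernel in `B` is included in the stage over `B` indexed by the set itself. -/
theorem sub_stage_self {B z : M} (hz : KernelIn B z) : Sub z (stage B z) := by
  refine mem_induction (P := fun z => KernelIn B z → Sub z (stage B z))
    (fun z ih hz w hw => ?_) z hz
  rw [mem_stage]
  by_cases h : IsUr w
  · exact Or.inl (hz.mem hw w (inTC_self w) h)
  · exact Or.inr ⟨h, w, hw, ih w hw (hz.mem hw)⟩

/-- Unlike `z` itself, the index `rank z` is pure. It can thus belong to a level over A even when
`z` involves urelements outside A. -/
theorem sub_stage_rank {B z : M} (hz : KernelIn B z) : Sub z (stage B (rank z)) := by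
  refine mem_induction (P := fun z => KernelIn B z → Sub z (stage B (rank z)))
    (fun z ih hz w hw => ?_) z hz
  rw [mem_stage]
  by_cases h : IsUr w
  · exact Or.inl (hz.mem hw w (inTC_self w) h)
  · exact Or.inr ⟨h, rank w, mem_rank.2 ⟨w, hw, rfl⟩, ih w hw (hz.mem hw)⟩

/-- Double induction on membership. If neither stage is included in a stage with index in the
other's index, then by the induction hypotheses all earlier stages of each belong to the other, and
the two have the same members. -/
theorem stage_comparable {B : M} (hB : IsUrSet B) (d e : M) :
    stage B d ∈ᵤ stage B e ∨ stage B d = stage B e ∨ stage B e ∈ᵤ stage B d := by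
  refine mem_induction (P := fun d => ∀ e, stage B d ∈ᵤ stage B e ∨ stage B d = stage B e ∨
    stage B e ∈ᵤ stage B d) (fun d ihd => ?_) d e
  refine mem_induction fun e ihe => ?_
  by_cases h1 : ∃ c, c ∈ᵤ e ∧ Sub (stage B d) (stage B c)
  · exact Or.inl (mem_stage.2 (Or.inr ⟨isSet_stage _ _, h1⟩))
  by_cases h2 : ∃ c, c ∈ᵤ d ∧ Sub (stage B e) (stage B c)
  · exact Or.inr (Or.inr (mem_stage.2 (Or.inr ⟨isSet_stage _ _, h2⟩)))
  have key : ∀ d e : M, (∀ c, c ∈ᵤ d → stage B c ∈ᵤ stage B e) →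
      Sub (stage B d) (stage B e) := by
    intro d e h z hz
    rcases mem_stage.1 hz with hz | ⟨hzs, c, hc, hz⟩
    · exact mem_stage.2 (Or.inl hz)
    · rcases mem_stage.1 (h c hc) with hcB | ⟨-, b, hb, hcb⟩
      · exact (isSet_stage _ _ (hB.2 _ hcB)).elim
      · exact mem_stage.2 (Or.inr ⟨hzs, b, hb, fun w hw => hcb w (hz w hw)⟩)
  refine Or.inr (Or.inl (ext_set (isSet_stage _ _) (isSet_stage _ _) fun z =>
    ⟨key d e (fun c hc => ?_) z, key e d (fun c hc => ?_) z⟩))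
  · rcases ihd c hc e with h | h | h
    · exact h
    · exact (h2 ⟨c, hc, h ▸ fun _ h => h⟩).elim
    · exact (h2 ⟨c, hc, fun w hw => (isTrans_stage hB c).2 _ w h hw⟩).elim
  · rcases ihe c hc with h | h | h
    · exact (h1 ⟨c, hc, fun w hw => (isTrans_stage hB c).2 _ w h hw⟩).elim
    · exact (h1 ⟨c, hc, h ▸ fun _ h => h⟩).elim
    · exact h

/-! ### Levels, and a substitute for Collection. -/

/-- `l` is a level of the cumulative hierarchy over `B`. -/
def IsLevel (B l : M) : Prop := ∃ d, l = stage B d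

instance {a b : (ι → M) → M} [DefTerm a] [DefTerm b] : DefPred fun v => IsLevel (a v) (b v) := by
  unfold IsLevel; infer_instance

theorem IsLevel.isSet {B l : M} (h : IsLevel B l) : IsSet l := by
  obtain ⟨d, rfl⟩ := h
  exact isSet_stage B d

theorem IsLevel.kernelIn {B l : M} (hB : IsUrSet B) (h : IsLevel B l) : KernelIn B l := by
  obtain ⟨d, rfl⟩ := h
  exact kernelIn_stage hB d

theorem IsLevel.sub_of_mem {B l z : M} (hB : IsUrSet B) (h : IsLevel B l) (hz : z ∈ᵤ l) :
    Sub z l := by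
  obtain ⟨d, rfl⟩ := h
  exact fun w hw => (isTrans_stage hB d).2 z w hz hw

theorem IsLevel.mem_or_sub {B l m : M} (hB : IsUrSet B) (hl : IsLevel B l) (hm : IsLevel B m) :
    l ∈ᵤ m ∨ Sub m l := by
  obtain ⟨d, rfl⟩ := hl
  obtain ⟨e, rfl⟩ := hm
  rcases stage_comparable hB d e with h | h | h
  · exact Or.inl h
  · exact Or.inr (h ▸ fun _ h => h)
  · exact Or.inr (IsLevel.sub_of_mem hB ⟨d, rfl⟩ h)

theorem IsLevel.sub_total {B l m : M} (hB : IsUrSet B) (hl : IsLevel B l) (hm : IsLevel B m) :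
    Sub l m ∨ Sub m l :=
  (hl.mem_or_sub hB hm).imp (hm.sub_of_mem hB) id

/-- Comparability makes the least level unique, hence definable without Choice. This turns
Replacement into a form of Collection for levels. -/
theorem exists_least_level {B : M} (hB : IsUrSet B) {P : M → Prop} [hP : DefSet P]
    (h : ∃ l, IsLevel B l ∧ P l) :
    ∃! l, (IsLevel B l ∧ P l) ∧ ∀ m, IsLevel B m → P m → Sub l m := by
  have inst {ι : Type} (t : (ι → M) → M) [DefTerm t] : DefPred fun v => P (t v) := hP.comp t
  obtain ⟨l, hl⟩ := h
  obtain ⟨m, hm, hmin⟩ := exists_minimal (P := fun l => IsLevel B l ∧ P l) hl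
  have hle : ∀ k, IsLevel B k → P k → Sub m k := fun k hk hPk =>
    (hk.mem_or_sub hB hm.1).elim (fun h => (hmin k h ⟨hk, hPk⟩).elim) id
  refine ⟨m, ⟨hm, hle⟩, fun k hk => ?_⟩
  exact ext_set hk.1.1.isSet hm.1.isSet fun z => ⟨hk.2 m hm.1 hm.2 z, hle k hk.1.1 hk.1.2 z⟩

theorem exists_level_mem (B s : M) :
    ∃ l, IsLevel B l ∧ ∀ z, z ∈ᵤ s → IsSet z → KernelIn B z → z ∈ᵤ l :=
  ⟨stage B s, ⟨s, rfl⟩, fun z hz hzs hk => mem_stage.2 (Or.inr ⟨hzs, z, hz, sub_stage_self hk⟩)⟩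

/-- Collection for monotone conditions on levels. -/
theorem exists_level_forall_mem {B : M} (hB : IsUrSet B) (x : M) {P : M → M → Prop}
    [hP : DefRel P]
    (hmono : ∀ a l m, a ∈ᵤ x → IsLevel B l → IsLevel B m → Sub l m → P a l → P a m)
    (h : ∀ a, a ∈ᵤ x → ∃ l, IsLevel B l ∧ P a l) :
    ∃ l, IsLevel B l ∧ ∀ a, a ∈ᵤ x → P a l := by
  have inst {ι : Type} (s t : (ι → M) → M) [DefTerm s] [DefTerm t] :
    DefPred fun v => P (s v) (t v) := hP.comp s t
  have huniq : ∀ a, a ∈ᵤ x → ∃! l, (IsLevel B l ∧ P a l) ∧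
      ∀ m, IsLevel B m → P a m → Sub l m := fun a ha => exists_least_level hB (h a ha)
  have hs := small_image_rel huniq
  obtain ⟨l, hl, hmem⟩ := exists_level_mem B (coll _ : M)
  refine ⟨l, hl, fun a ha => ?_⟩
  obtain ⟨m, hm, -⟩ := huniq a ha
  exact hmono a m l ha hm.1.1 hl (hl.sub_of_mem hB (hmem m ((mem_coll hs).2 ⟨a, ha, hm⟩)
    hm.1.1.isSet (hm.1.1.kernelIn hB))) hm.1.2

/-- Induction on the number of coordinates: with one coordinate fixed, bounding all the others is
again a monotone definable condition on levels. -/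
theorem exists_level_forall_tuple {B : M} (hB : IsUrSet B) (x : M) (κ : Type) [Finite κ]
    {P : (κ → M) → M → Prop}
    (hP : DefPred fun w : κ ⊕ Unit → M => P (fun k => w (.inl k)) (w (.inr ())))
    (hmono : ∀ a l m, (∀ k, a k ∈ᵤ x) → IsLevel B l → IsLevel B m → Sub l m → P a l → P a m)
    (h : ∀ a, (∀ k, a k ∈ᵤ x) → ∃ l, IsLevel B l ∧ P a l) :
    ∃ l, IsLevel B l ∧ ∀ a, (∀ k, a k ∈ᵤ x) → P a l := by
  induction κ using Finite.induction_empty_option with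
  | of_equiv e ih =>
    rename_i α β
    obtain ⟨l, hl, H⟩ := ih (P := fun a l => P (fun k => a (e.symm k)) l)
      (hP.preimage_comp (Sum.map e.symm id))
      (fun a l m ha => hmono _ l m fun k => ha _) (fun a ha => h _ fun k => ha _)
    refine ⟨l, hl, fun a ha => ?_⟩
    simpa using H (fun k => a (e k)) fun k => ha _
  | h_empty =>
    obtain ⟨l, hl, H⟩ := h PEmpty.elim (fun k => k.elim)
    exact ⟨l, hl, fun a _ => (Subsingleton.elim _ _ : PEmpty.elim = a) ▸ H⟩
  | h_option ih =>
    rename_i α _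
    let c : M → (α → M) → Option α → M := fun b a k => k.elim b a
    have hR : DefRel fun b l => ∀ a : α → M, (∀ k, a k ∈ᵤ x) → P (c b a) l := by
      refine ⟨DefPred.forall_tuple ?_⟩
      have h1 : DefPred fun w : Bool ⊕ α → M => ∀ k, w (.inr k) ∈ᵤ x :=
        DefPred.forall_finite fun k => inferInstance
      have h2 : DefPred fun w : Bool ⊕ α → M =>
          P (c (w (.inl false)) fun k => w (.inr k)) (w (.inl true)) := by
        refine (hP.preimage_comp (Sum.elim (fun k => k.elim (.inl false) .inr)
          fun _ => .inl true)).congr fun w => ?_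
        have : (c (w (.inl false)) fun k => w (.inr k)) =
            fun k : Option α => w (k.elim (.inl false) .inr) := by
          funext k
          cases k <;> rfl
        rw [this]
        rfl
      exact DefPred.imp
    have hc : ∀ b a, b ∈ᵤ x → (∀ k, a k ∈ᵤ x) → ∀ k, c b a k ∈ᵤ x := by
      rintro b a hb ha (_ | k)
      · exact hb
      · exact ha k
    have hPc : ∀ b, DefPred fun w : α ⊕ Unit → M =>
        P (c b fun k => w (.inl k)) (w (.inr ())) := by
      intro b
      have := hP.subst (ι := α ⊕ Unit) (t := Sum.elim (fun k w => c b (fun k => w (.inl k)) k)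
        fun _ w => w (.inr ())) (by
          rintro ((_ | k) | _)
          · exact DefTerm.const b
          · exact DefTerm.var _
          · exact DefTerm.var _)
      exact this
    obtain ⟨l, hl, H⟩ := exists_level_forall_mem hB x
      (P := fun b l => ∀ a : α → M, (∀ k, a k ∈ᵤ x) → P (c b a) l)
      (fun b l m hb hl hm hlm H a ha => hmono _ l m (hc b a hb ha) hl hm hlm (H a ha))
      (fun b hb => ih (P := fun a l => P (c b a) l) (hPc b)
        (fun a l m ha => hmono _ l m (hc b a hb ha)) fun a ha => h _ (hc b a hb ha))
    refine ⟨l, hl, fun a ha => ?_⟩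
    have := H (a none) (ha none) (fun k => a (some k)) fun k => ha _
    have e : c (a none) (fun k => a (some k)) = a := by
      funext k
      cases k <;> rfl
    rwa [e] at this

/-- Universality enters only through this inclusion. The converse is not needed, so the stages never
have to be matched with the ordinal-indexed hierarchy. -/
theorem KernelIn.of_inV {A x : M} (hA : IsUrSet A) (hx : InV A x) : KernelIn A x := by
  obtain ⟨δ, f, α, v, ⟨hδ, hf, H⟩, hv, hxv⟩ := hx
  refine mem_induction (P := fun β => ∀ v, Maps f β v → ∀ z, z ∈ᵤ v → KernelIn A z)
    (fun β ih v hv z hz => ?_) α v hv x hxv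
  have hβδ : β ∈ᵤ δ := (hf.2.2.2 β).2 ⟨v, hv⟩
  have hβ := hδ.of_mem hβδ
  obtain ⟨h0, hs, hl⟩ := H β v hv
  by_cases hβ0 : IsEmptySet β
  · exact .of_mem hA (h0 hβ0 ▸ hz)
  by_cases hβs : ∃ γ, IsOrd γ ∧ IsSucc β γ
  · obtain ⟨γ, -, hγ⟩ := hβs
    have hγβ : γ ∈ᵤ β := (hγ.2 γ).2 (Or.inr rfl)
    obtain ⟨w, hw⟩ := (hf.2.2.2 γ).1 (hδ.1.2 β γ hβδ hγβ)
    rcases ((hs γ w hγ hw).2 z).1 hz with ⟨hzs, hzw⟩ | hzA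
    · exact .of_isSet hzs fun y hy => ih γ hγβ w hw y (hzw y hy)
    · exact .of_mem hA hzA
  · obtain ⟨γ, w, hγ, hw, hzw⟩ := ((hl ⟨hβ, hβ0, hβs⟩).2 z).1 hz
    exact ih γ hγ w hw z hzw

end Hierarchy

/-! ### Definable automorphisms induced by permuting urelements. -/

section Automorphisms

variable {M : Type u} [lang.Structure M] {ι : Type}

/-- An automorphism of the universe which, like its inverse, is a definable class function. -/
structure DefAut (M : Type u) [lang.Structure M] where
  /-- the automorphism -/
  toFun : M → M
  /-- its inverse -/
  inv : M → M
  left_inv : ∀ x, inv (toFun x) = x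
  right_inv : ∀ x, toFun (inv x) = x
  mem_iff : ∀ x y, toFun x ∈ᵤ toFun y ↔ x ∈ᵤ y
  isUr_iff : ∀ x, IsUr (toFun x) ↔ IsUr x
  defFun : DefFun toFun
  defFun_inv : DefFun inv

namespace DefAut

variable (π : DefAut M)

/-- The inverse automorphism. -/
def symm : DefAut M where
  toFun := π.inv
  inv := π.toFun
  left_inv := π.right_inv
  right_inv := π.left_inv
  mem_iff x y := by rw [← π.mem_iff, π.right_inv, π.right_inv]
  isUr_iff x := by rw [← π.isUr_iff, π.right_inv]
  defFun := π.defFun_inv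
  defFun_inv := π.defFun

/-- The composition of two automorphisms. -/
def comp (ρ : DefAut M) : DefAut M where
  toFun x := π.toFun (ρ.toFun x)
  inv x := ρ.inv (π.inv x)
  left_inv x := by rw [π.left_inv, ρ.left_inv]
  right_inv x := by rw [ρ.right_inv, π.right_inv]
  mem_iff x y := by rw [π.mem_iff, ρ.mem_iff]
  isUr_iff x := by rw [π.isUr_iff, ρ.isUr_iff]
  defFun := ⟨haveI := ρ.defFun.comp fun v : Unit → M => v (); π.defFun.comp _⟩
  defFun_inv := ⟨haveI := π.defFun_inv.comp fun v : Unit → M => v (); ρ.defFun_inv.comp _⟩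

/-- An automorphism as an isomorphism of first-order structures. -/
def toEquiv : M ≃[lang] M where
  toFun := π.toFun
  invFun := π.inv
  left_inv := π.left_inv
  right_inv := π.right_inv
  map_fun' f := Empty.elim f
  map_rel' {n} r x := by
    cases r with
    | ur =>
      have h : ∀ y : Fin 1 → M, y = ![y 0] := fun y => by
        funext i; fin_cases i; rfl
      rw [h x, h (π.toFun ∘ _)]
      exact π.isUr_iff (x 0)
    | mem =>
      have h : ∀ y : Fin 2 → M, y = ![y 0, y 1] := fun y => by
        funext i; fin_cases i <;> rfl
      rw [h x, h (π.toFun ∘ _)]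
      exact π.mem_iff (x 0) (x 1)

theorem realize_iff {α : Type*} {n : ℕ} (φ : lang.BoundedFormula α n) (v : α → M)
    (xs : Fin n → M) :
    φ.Realize (fun i => π.toFun (v i)) (fun i => π.toFun (xs i)) ↔ φ.Realize v xs :=
  Language.StrongHomClass.realize_boundedFormula π.toEquiv φ

theorem mem_toFun_iff {x y : M} : x ∈ᵤ π.toFun y ↔ π.inv x ∈ᵤ y := by
  rw [← π.mem_iff (π.inv x) y, π.right_inv]

theorem isUrSet_map {B : M} (hB : IsUrSet B) : IsUrSet (π.toFun B) :=
  ⟨fun h => hB.1 ((π.isUr_iff B).1 h),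
    fun a ha => (π.symm.isUr_iff a).1 (hB.2 _ (π.mem_toFun_iff.1 ha))⟩

variable [hM : Fact (ModelsZFUR M)]

/-- An automorphism fixing the members of `B` fixes every object with kernel in `B`. -/
theorem toFun_eq_self {B : M} (hB : ∀ u, u ∈ᵤ B → π.toFun u = u) {z : M} (hz : KernelIn B z) :
    π.toFun z = z := by
  have inst {ι : Type} (t : (ι → M) → M) [DefTerm t] : DefTerm fun v => π.toFun (t v) :=
    π.defFun.comp t
  refine mem_induction (P := fun z => KernelIn B z → π.toFun z = z) (fun z ih hz => ?_) z hz
  by_cases h : IsUr z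
  · exact hB z (hz z (inTC_self z) h)
  · refine ext_set (fun h' => h ((π.isUr_iff z).1 h')) h fun w => ⟨fun hw => ?_, fun hw => ?_⟩
    · have hw' := π.mem_toFun_iff.1 hw
      have := ih _ hw' (hz.mem hw')
      rw [π.right_inv] at this
      exact this ▸ hw'
    · exact ih w hw (hz.mem hw) ▸ (π.mem_iff w z).2 hw

theorem toFun_mem_stage {B C : M} (hBC : ∀ u, u ∈ᵤ B → π.toFun u ∈ᵤ C) {d z : M}
    (hz : z ∈ᵤ stage B d) : π.toFun z ∈ᵤ stage C (π.toFun d) := by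
  have inst {ι : Type} (t : (ι → M) → M) [DefTerm t] : DefTerm fun v => π.toFun (t v) :=
    π.defFun.comp t
  refine mem_induction (P := fun d => ∀ z, z ∈ᵤ stage B d →
    π.toFun z ∈ᵤ stage C (π.toFun d)) (fun d ih z hz => ?_) d z hz
  rw [mem_stage] at hz ⊢
  refine hz.imp (hBC z) fun ⟨hzs, e, he, hze⟩ => ⟨fun h => hzs ((π.isUr_iff z).1 h),
    π.toFun e, (π.mem_iff _ _).2 he, fun w hw => ?_⟩
  rw [← π.right_inv w]
  exact ih e he _ (hze _ (π.mem_toFun_iff.1 hw))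

theorem injectsInto_map {x : M} {C D : M → Prop} (h : InjectsInto x C)
    (hCD : ∀ z, C z → D (π.toFun z)) : InjectsInto (π.toFun x) D := by
  obtain ⟨g, hg, hinj, hC⟩ := injectsInto_iff.1 h
  have inst {ι : Type} (t : (ι → M) → M) [DefTerm t] : DefTerm fun v => π.toFun (t v) :=
    π.defFun.comp t
  have inst' {ι : Type} (t : (ι → M) → M) [DefTerm t] : DefTerm fun v => π.inv (t v) :=
    π.defFun_inv.comp t
  have inst'' {ι : Type} (t : (ι → M) → M) [DefTerm t] : DefTerm fun v => g (t v) := hg.comp t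
  refine injectsInto_iff.2 ⟨fun a => π.toFun (g (π.inv a)), inferInstance,
    fun a b ha hb hab => ?_, fun a ha => hCD _ (hC _ (π.mem_toFun_iff.1 ha))⟩
  have h1 := congrArg π.inv hab
  simp only [π.left_inv] at h1
  have h2 := congrArg π.toFun (hinj _ _ (π.mem_toFun_iff.1 ha) (π.mem_toFun_iff.1 hb) h1)
  simpa only [π.right_inv] using h2

end DefAut

variable [hM : Fact (ModelsZFUR M)]

/-- A definable involution of the urelements extends to an automorphism. -/
theorem exists_defAut (s : M → M) [hs : DefFun s] (hur : ∀ u, IsUr u → IsUr (s u))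
    (hss : ∀ u, IsUr u → s (s u) = u) : ∃ π : DefAut M, ∀ u, IsUr u → π.toFun u = s u := by
  classical
  have inst {ι : Type} (t : (ι → M) → M) [DefTerm t] : DefTerm fun v => s (t v) := hs.comp t
  obtain ⟨F, hF, hrec⟩ := exists_mem_recursion (M := M)
    (fun _ y i => if IsUr y then s y else i) fun _ y i => by
      intros
      refine DefTerm.of_graph (P := fun v z => (IsUr (y v) ∧ z = s (y v)) ∨
        ¬ IsUr (y v) ∧ z = i v) inferInstance fun v z => ?_
      by_cases h : IsUr (y v) <;> simp [h]
  let f : M → M := F (empty M)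
  have hf {ι : Type} (t : (ι → M) → M) [DefTerm t] : DefTerm fun v => f (t v) :=
    hF.comp (fun _ => empty M) t
  have hfu : ∀ u, IsUr u → f u = s u := fun u hu => by
    rw [show f u = _ from hrec _ _, if_pos hu]
  have hsm := fun y => small_image y f
  have hfs : ∀ y, IsSet y → f y = coll fun w => ∃ z, z ∈ᵤ y ∧ w = f z := fun y hy => by
    rw [show f y = _ from hrec _ _, if_neg hy]
  have hset : ∀ y, IsUr (f y) ↔ IsUr y := by
    intro y
    by_cases hy : IsUr y
    · simp only [hfu y hy, hur y hy, hy]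
    · exact iff_of_false (hfs y hy ▸ isSet_coll (hsm y)) hy
  have hmem : ∀ x y, x ∈ᵤ y → f x ∈ᵤ f y := fun x y h => by
    rw [hfs y (isSet_of_mem h), mem_coll (hsm y)]
    exact ⟨x, h, rfl⟩
  -- The extension of an involution is an involution, so `f` is its own inverse.
  have hff : ∀ y, f (f y) = y := by
    refine mem_induction fun y ih => ?_
    by_cases hy : IsUr y
    · rw [hfu y hy, hfu _ (hur y hy), hss y hy]
    · have hfy : IsSet (f y) := fun h => hy ((hset y).1 h)
      refine ext_set (fun h => hfy ((hset _).1 h)) hy fun w => ?_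
      rw [hfs _ hfy, mem_coll (hsm _)]
      constructor
      · rintro ⟨z, hz, rfl⟩
        rw [hfs y hy, mem_coll (hsm y)] at hz
        obtain ⟨x, hx, rfl⟩ := hz
        exact (ih x hx).symm ▸ hx
      · exact fun hw => ⟨f w, hmem w y hw, (ih w hw).symm⟩
  exact ⟨⟨f, f, hff, hff, fun x y => ⟨fun h => hff x ▸ hff y ▸ hmem _ _ h, hmem x y⟩, hset,
    ⟨hf _⟩, ⟨hf _⟩⟩, hfu⟩

/-- Disjoint equinumerous sets of urelements are exchanged by an automorphism which fixes the
other urelements. -/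
theorem exists_defAut_swap {C D : M} (hC : IsUrSet C) (hD : IsUrSet D)
    (hCD : ∀ u, u ∈ᵤ C → ¬ u ∈ᵤ D) (h : Equinumerous C D) :
    ∃ π : DefAut M, (∀ u, u ∈ᵤ C → π.toFun u ∈ᵤ D) ∧
      ∀ u, IsUr u → ¬ u ∈ᵤ C → ¬ u ∈ᵤ D → π.toFun u = u := by
  classical
  obtain ⟨g, k, hg, hk, hgk, hkg⟩ := h.exists_defFun
  have inst {ι : Type} (t : (ι → M) → M) [DefTerm t] : DefTerm fun v => g (t v) := hg.comp t
  have inst' {ι : Type} (t : (ι → M) → M) [DefTerm t] : DefTerm fun v => k (t v) := hk.comp t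
  let s : M → M := fun u => if u ∈ᵤ C then g u else if u ∈ᵤ D then k u else u
  have hs1 : ∀ u, u ∈ᵤ C → s u = g u := fun u hu => if_pos hu
  have hs2 : ∀ u, u ∈ᵤ D → s u = k u := fun u hu =>
    (if_neg fun h => hCD u h hu).trans (if_pos hu)
  have hs3 : ∀ u, ¬ u ∈ᵤ C → ¬ u ∈ᵤ D → s u = u := fun u h1 h2 =>
    (if_neg h1).trans (if_neg h2)
  have hs : DefFun s := by
    refine ⟨DefTerm.of_graph (P := fun v z => (v () ∈ᵤ C ∧ z = g (v ())) ∨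
      ¬ v () ∈ᵤ C ∧ ((v () ∈ᵤ D ∧ z = k (v ())) ∨ ¬ v () ∈ᵤ D ∧ z = v ())) inferInstance
      fun v z => ?_⟩
    by_cases h1 : v () ∈ᵤ C <;> by_cases h2 : v () ∈ᵤ D <;> simp [s, h1, h2]
  obtain ⟨π, hπ⟩ := exists_defAut s
    (fun u hu => by
      by_cases h1 : u ∈ᵤ C
      · rw [hs1 u h1]
        exact hD.2 _ (hgk u h1).1
      by_cases h2 : u ∈ᵤ D
      · rw [hs2 u h2]
        exact hC.2 _ (hkg u h2).1
      rwa [hs3 u h1 h2])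
    (fun u hu => by
      by_cases h1 : u ∈ᵤ C
      · rw [hs1 u h1, hs2 _ (hgk u h1).1, (hgk u h1).2]
      by_cases h2 : u ∈ᵤ D
      · rw [hs2 u h2, hs1 _ (hkg u h2).1, (hkg u h2).2]
      rw [hs3 u h1 h2, hs3 u h1 h2])
  refine ⟨π, fun u hu => ?_, fun u hu h1 h2 => (hπ u hu).trans (hs3 u h1 h2)⟩
  rw [hπ u (hC.2 u hu), hs1 u hu]
  exact (hgk u hu).1

theorem equinumerous_image {x : M} (g : M → M) [hg : DefFun g]
    (hinj : ∀ a b, a ∈ᵤ x → b ∈ᵤ x → g a = g b → a = b) :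
    Equinumerous x (coll fun b => ∃ a, a ∈ᵤ x ∧ b = g a) := by
  refine ⟨graphOn g x, isInjOn_graphOn hinj, fun b => ?_⟩
  simp only [mem_coll (small_image x g), maps_graphOn]

/-- Under Plenitude⁺, every set is equinumerous with a set of urelements disjoint from a given
set. -/
theorem PlenitudePlus.exists_disjoint (hPl : PlenitudePlus M) {X B : M}
    (hB : IsSet B) : ∃ E, IsUrSet E ∧ (∀ u, u ∈ᵤ E → ¬ u ∈ᵤ B) ∧ Equinumerous X E := by
  have hpow := small_pow hB
  obtain ⟨E', hE', h⟩ := hPl (prod X (coll fun z => IsSet z ∧ Sub z B)) (isSet_prod _ _)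
  obtain ⟨g, k, hg, hk, hgk, -⟩ := h.exists_defFun
  have inst {ι : Type} (t : (ι → M) → M) [DefTerm t] : DefTerm fun v => g (t v) := hg.comp t
  have hmem : ∀ a K, a ∈ᵤ X → IsSet K → Sub K B →
      opair a K ∈ᵤ prod X (coll fun z => IsSet z ∧ Sub z B) := fun a K ha hK hKB =>
    mem_prod.2 ⟨a, ha, K, (mem_coll hpow).2 ⟨hK, hKB⟩, rfl⟩
  have hinj : ∀ a K a' K', a ∈ᵤ X → IsSet K → Sub K B → a' ∈ᵤ X → IsSet K' → Sub K' B →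
      g (opair a K) = g (opair a' K') → a = a' ∧ K = K' := by
    intro a K a' K' ha hK hKB ha' hK' hKB' h
    rw [← opair_inj, ← (hgk _ (hmem a K ha hK hKB)).2, h, (hgk _ (hmem a' K' ha' hK' hKB')).2]
  -- Each subset K of B gives a copy of X. If every copy met B, some subset of B would map onto
  -- P(B), and Cantor's diagonal set Δ refutes this.
  obtain ⟨K, hK, hKB, hKX⟩ : ∃ K, IsSet K ∧ Sub K B ∧ ∀ a, a ∈ᵤ X → ¬ g (opair a K) ∈ᵤ B := by
    by_contra! hcon
    have hs := small_sep B fun u => ∃ a K, a ∈ᵤ X ∧ IsSet K ∧ Sub K B ∧ u = g (opair a K) ∧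
      ¬ u ∈ᵤ K
    generalize hΔ : coll (fun u => u ∈ᵤ B ∧ ∃ a K, a ∈ᵤ X ∧ IsSet K ∧ Sub K B ∧
      u = g (opair a K) ∧ ¬ u ∈ᵤ K) = Δ
    have hΔs : IsSet Δ := hΔ ▸ isSet_coll hs
    have hΔm : ∀ u, u ∈ᵤ Δ ↔ u ∈ᵤ B ∧ ∃ a K, a ∈ᵤ X ∧ IsSet K ∧ Sub K B ∧
      u = g (opair a K) ∧ ¬ u ∈ᵤ K := fun u => hΔ ▸ mem_coll hs
    have hΔB : Sub Δ B := fun u hu => ((hΔm u).1 hu).1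
    obtain ⟨a, ha, hau⟩ := hcon Δ hΔs hΔB
    by_cases hu : g (opair a Δ) ∈ᵤ Δ
    · obtain ⟨-, a', K, ha', hK, hKB, he, hn⟩ := (hΔm _).1 hu
      obtain ⟨-, rfl⟩ := hinj a Δ a' K ha hΔs hΔB ha' hK hKB he
      exact hn hu
    · exact hu ((hΔm _).2 ⟨hau, a, Δ, ha, hΔs, hΔB, rfl, hu⟩)
  have hsm := small_image X fun a => g (opair a K)
  refine ⟨_, ⟨isSet_coll hsm, fun u hu => ?_⟩, fun u hu => ?_, equinumerous_image
    (fun a => g (opair a K)) fun a b ha hb hab => (hinj a K b K ha hK hKB hb hK hKB hab).1⟩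
  · obtain ⟨a, ha, rfl⟩ := (mem_coll hsm).1 hu
    exact hE'.2 _ (hgk _ (hmem a K ha hK hKB)).1
  · obtain ⟨a, ha, rfl⟩ := (mem_coll hsm).1 hu
    exact hKX a ha

/-- Under Plenitude⁺, a set of urelements disjoint from `B` can be moved into any set of
urelements disjoint from `B` into which it injects, by an automorphism fixing `B` pointwise. -/
theorem PlenitudePlus.exists_defAut (hPl : PlenitudePlus M) {B C D : M} (hB : IsUrSet B)
    (hC : IsUrSet C) (hD : IsUrSet D) (hCB : ∀ u, u ∈ᵤ C → ¬ u ∈ᵤ B)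
    (hDB : ∀ u, u ∈ᵤ D → ¬ u ∈ᵤ B) (h : InjectsInto C fun u => u ∈ᵤ D) :
    ∃ π : DefAut M, (∀ u, u ∈ᵤ B → π.toFun u = u) ∧ ∀ u, u ∈ᵤ C → π.toFun u ∈ᵤ D := by
  obtain ⟨f, hf, hfinj, hfD⟩ := injectsInto_iff.1 h
  -- C and D may overlap, so one swap does not suffice. A fresh copy E of C mediates: swap C with E,
  -- then E with the copy D' of C inside D.
  obtain ⟨E, hE, hdisj, hCE⟩ := hPl.exists_disjoint (X := C) (isSet_union (union B C) D)
  simp only [mem_union, not_or] at hdisj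
  obtain ⟨g, k, hg, hk, hgk, hkg⟩ := hCE.exists_defFun
  have inst {ι : Type} (t : (ι → M) → M) [DefTerm t] : DefTerm fun v => f (t v) := hf.comp t
  have inst' {ι : Type} (t : (ι → M) → M) [DefTerm t] : DefTerm fun v => k (t v) := hk.comp t
  have hED := equinumerous_image (x := E) (fun u => f (k u)) fun a b ha hb hab => by
    rw [← (hkg a ha).2, ← (hkg b hb).2, hfinj _ _ (hkg a ha).1 (hkg b hb).1 hab]
  have hsm := small_image E fun u => f (k u)
  generalize hDe : coll (fun b => ∃ a, a ∈ᵤ E ∧ b = f (k a)) = D' at hED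
  have hD'D : Sub D' D := by
    intro u hu
    rw [← hDe, mem_coll hsm] at hu
    obtain ⟨a, ha, rfl⟩ := hu
    exact hfD _ (hkg a ha).1
  have hD' : IsUrSet D' := ⟨hDe ▸ isSet_coll hsm, fun u hu => hD.2 u (hD'D u hu)⟩
  obtain ⟨π, hπ, hπ'⟩ := exists_defAut_swap hC hE (fun u h1 h2 => (hdisj u h2).1.2 h1) hCE
  obtain ⟨ρ, hρ, hρ'⟩ := exists_defAut_swap hE hD' (fun u h1 h2 => (hdisj u h1).2 (hD'D u h2))
    hED
  refine ⟨ρ.comp π, fun u hu => ?_, fun u hu => hD'D _ (hρ _ (hπ u hu))⟩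
  have hE' : ¬ u ∈ᵤ E := fun h => (hdisj u h).1.1 hu
  change ρ.toFun (π.toFun u) = u
  rw [hπ' u (hB.2 u hu) (fun h => hCB u h hu) hE',
    hρ' u (hB.2 u hu) hE' fun h => hDB u (hD'D u h) hu]

end Automorphisms

/-! ### Bounding counterexamples by levels over A. -/

section Reflection

variable {M : Type u} [lang.Structure M] {ι κ : Type}

/-- `E` is a set of urelements disjoint from `A`. -/
def IsUrSetOff (A E : M) : Prop := IsUrSet E ∧ ∀ u, u ∈ᵤ E → ¬ u ∈ᵤ A

instance {a b : (ι → M) → M} [DefTerm a] [DefTerm b] :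
    DefPred fun v => IsUrSetOff (a v) (b v) := by
  unfold IsUrSetOff; infer_instance

theorem DefPred.comp_param {Q : (κ → M) → M → Prop} [Finite κ]
    (hQ : DefPred fun w : κ ⊕ Unit → M => Q (fun k => w (.inl k)) (w (.inr ())))
    (f : κ → ι) (t : (ι → M) → M) [ht : DefTerm t] :
    DefPred fun v => Q (fun k => v (f k)) (t v) :=
  hQ.subst (t := Sum.elim (fun k v => v (f k)) fun _ => t) (by
    rintro (k | _)
    · exact DefTerm.var _
    · exact ht)

/-- The counterexamples to a universally quantified formula. -/
def Counterexample {n k : ℕ} (φ : lang.BoundedFormula (Fin n) (k + 1)) (a : Fin n ⊕ Fin k → M)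
    (y : M) : Prop :=
  ¬ φ.Realize (fun i => a (.inl i)) (Fin.snoc (fun j => a (.inr j)) y : Fin (k + 1) → M)

theorem defPred_counterexample {n k : ℕ} (φ : lang.BoundedFormula (Fin n) (k + 1)) :
    DefPred fun w : (Fin n ⊕ Fin k) ⊕ Unit → M =>
      Counterexample φ (fun k => w (.inl k)) (w (.inr ())) := by
  have h := (DefPred.realize (M := M) φ).preimage_comp (κ := (Fin n ⊕ Fin k) ⊕ Unit)
    (Sum.elim (fun i => .inl (.inl i))
      (Fin.snoc (α := fun _ => (Fin n ⊕ Fin k) ⊕ Unit) (fun j => .inl (.inr j)) (.inr ())))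
  refine (DefPred.not (hP := h)).congr fun w => ?_
  have he : (fun j : Fin (k + 1) => w (Sum.elim (fun i => .inl (.inl i))
      (Fin.snoc (α := fun _ => (Fin n ⊕ Fin k) ⊕ Unit) (fun j => .inl (.inr j)) (.inr ()))
      (.inr j : Fin n ⊕ Fin (k + 1)))) =
      (Fin.snoc (fun j => w (.inl (.inr j))) (w (.inr ())) : Fin (k + 1) → M) := by
    funext j
    refine Fin.lastCases ?_ (fun j => ?_) j <;> simp
  unfold Counterexample
  rw [he]
  rfl

theorem Counterexample.map {n k : ℕ} {φ : lang.BoundedFormula (Fin n) (k + 1)} (π : DefAut M)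
    {a : Fin n ⊕ Fin k → M} {y : M} (h : Counterexample φ a y) :
    Counterexample φ (fun k => π.toFun (a k)) (π.toFun y) := by
  refine (not_congr ?_).2 h
  rw [← π.realize_iff φ (fun i => a (.inl i))]
  have he : (Fin.snoc (fun j => π.toFun (a (.inr j))) (π.toFun y) : Fin (k + 1) → M) =
      fun j => π.toFun ((Fin.snoc (fun j => a (.inr j)) y : Fin (k + 1) → M) j) := by
    funext j
    refine Fin.lastCases ?_ (fun j => ?_) j <;> simp
  rw [he]

variable [hM : Fact (ModelsZFUR M)]

theorem isUrSet_union {A E : M} (hA : IsUrSet A) (hE : IsUrSet E) : IsUrSet (union A E) :=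
  ⟨isSet_union _ _, fun u hu => (mem_union.1 hu).elim (hA.2 u) (hE.2 u)⟩

/-- `E` is a set of urelements outside `A` that injects into `l × P(l)`. -/
def IsBounded (A l E : M) : Prop :=
  IsUrSetOff A E ∧
    InjectsInto E fun p => ∃ z N, z ∈ᵤ l ∧ IsSet N ∧ Sub N l ∧ p = opair z N

instance {a b c : (ι → M) → M} [DefTerm a] [DefTerm b] [DefTerm c] :
    DefPred fun v => IsBounded (a v) (b v) (c v) := by
  unfold IsBounded; infer_instance

/-- The condition `Q` on `y` has a solution which, modulo `A`, is of size and rank bounded by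
the level `m`. -/
def HasSolution (A m : M) (Q : M → Prop) : Prop :=
  ∃ E y, IsUrSetOff A E ∧ (InjectsInto E fun z => z ∈ᵤ m) ∧ y ∈ᵤ stage (union A E) m ∧ Q y

theorem HasSolution.mono {A m m' : M} {Q : M → Prop} (h : HasSolution A m Q) (hm : Sub m m') :
    HasSolution A m' Q := by
  obtain ⟨E, y, hE, hi, hy, hQ⟩ := h
  exact ⟨E, y, hE, hi.mono hm, stage_mono_right _ hm y hy, hQ⟩

/-- Solvable instances of `Q` with parameters bounded by `l` have solutions bounded by `m`. -/
def ClosesUnder (A : M) (Q : (κ → M) → M → Prop) (l m : M) : Prop :=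
  ∀ E, IsBounded A l E → ∀ a : κ → M, (∀ k, a k ∈ᵤ stage (union A E) l) → (∃ y, Q a y) →
    HasSolution A m (Q a)

theorem ClosesUnder.mono {A l m m' : M} {Q : (κ → M) → M → Prop} (h : ClosesUnder A Q l m)
    (hm : Sub m m') : ClosesUnder A Q l m' :=
  fun E hE a ha hy => (h E hE a ha hy).mono hm

theorem defRel_closesUnder [Finite κ] (A : M) {Q : (κ → M) → M → Prop}
    (hQ : DefPred fun w : κ ⊕ Unit → M => Q (fun k => w (.inl k)) (w (.inr ()))) :
    DefRel (ClosesUnder A Q) := by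
  have inst {ι : Type} (f : κ → ι) (t : (ι → M) → M) [ht : DefTerm t] :
    DefPred fun v => Q (fun k => v (f k)) (t v) := hQ.comp_param f t
  refine ⟨?_⟩
  have h : DefPred fun w : (Bool ⊕ Unit) ⊕ κ → M =>
      (∀ k, w (.inr k) ∈ᵤ stage (union A (w (.inl (.inr ())))) (w (.inl (.inl false)))) →
      (∃ y, Q (fun k => w (.inr k)) y) →
      HasSolution A (w (.inl (.inl true))) (Q fun k => w (.inr k)) := by
    have : DefPred fun w : (Bool ⊕ Unit) ⊕ κ → M => ∀ k,
      w (.inr k) ∈ᵤ stage (union A (w (.inl (.inr ())))) (w (.inl (.inl false))) :=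
      DefPred.forall_finite fun k => inferInstance
    unfold HasSolution
    infer_instance
  have : DefPred fun w : Bool ⊕ Unit → M => ∀ a : κ → M,
      (∀ k, a k ∈ᵤ stage (union A (w (.inr ()))) (w (.inl false))) →
      (∃ y, Q a y) → HasSolution A (w (.inl true)) (Q a) := DefPred.forall_tuple h
  unfold ClosesUnder
  infer_instance

/-- Any solution is bounded by some level. -/
theorem exists_level_hasSolution {A : M} (hA : IsUrSet A)
    (hU : ∀ x : M, IsSet x → InjectsInto x (KernelIn A)) {Q : M → Prop} {y : M} (hy : Q y) :
    ∃ m, IsLevel A m ∧ HasSolution A m Q := by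
  obtain ⟨t, ht, hyt⟩ := exists_isTrans_mem y
  have hs : Small fun u => InTC u y ∧ IsUr u ∧ ¬ u ∈ᵤ A :=
    small_of_sub (x := t) fun u hu => hu.1 t ht hyt
  obtain ⟨E, hEs, hE⟩ := hs
  have hker : KernelIn (union A E) y := fun u hu hur => by
    rw [mem_union, hE]
    by_cases h : u ∈ᵤ A
    · exact Or.inl h
    · exact Or.inr ⟨hu, hur, h⟩
  -- Universality copies the kernel of `y` outside A to a set with kernel in A. A level containing
  -- this copy and `rank y` bounds the solution.
  obtain ⟨g, hg, hinj, hgA⟩ := injectsInto_iff.1 (hU E hEs)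
  have hsm := small_image E g
  obtain ⟨m, hm, hmem⟩ := exists_level_mem A
    (pair (coll fun b => ∃ a, a ∈ᵤ E ∧ b = g a) (rank y))
  have h1 := hmem _ (mem_pair.2 (Or.inl rfl)) (isSet_coll hsm) (.of_isSet (isSet_coll hsm)
    fun w hw => by
      obtain ⟨a, ha, rfl⟩ := (mem_coll hsm).1 hw
      exact hgA a ha)
  have h2 := hmem _ (mem_pair.2 (Or.inr rfl)) (isSet_rank y) (kernelIn_rank A y)
  refine ⟨m, hm, E, y, ⟨⟨hEs, fun u hu => ((hE u).1 hu).2.1⟩, fun u hu => ((hE u).1 hu).2.2⟩,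
    injectsInto_iff.2 ⟨g, hg, hinj, fun a ha => hm.sub_of_mem hA h1 _
      ((mem_coll hsm).2 ⟨a, ha, rfl⟩)⟩, mem_stage.2 ?_, hy⟩
  by_cases h : IsUr y
  · exact Or.inl (hker y (inTC_self y) h)
  · exact Or.inr ⟨h, rank y, h2, sub_stage_rank hker⟩

theorem exists_level_closesUnder [Finite κ] (hPl : PlenitudePlus M) {A : M} (hA : IsUrSet A)
    (hU : ∀ x : M, IsSet x → InjectsInto x (KernelIn A)) {Q : (κ → M) → M → Prop}
    (hQ : DefPred fun w : κ ⊕ Unit → M => Q (fun k => w (.inl k)) (w (.inr ())))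
    (hinv : ∀ (π : DefAut M) a y, Q a y → Q (fun k => π.toFun (a k)) (π.toFun y))
    {l : M} (hl : IsLevel A l) : ∃ m, IsLevel A m ∧ ClosesUnder A Q l m := by
  have inst {ι : Type} (f : κ → ι) (t : (ι → M) → M) [ht : DefTerm t] :
    DefPred fun v => Q (fun k => v (f k)) (t v) := hQ.comp_param f t
  have hpow := small_pow hl.isSet
  -- E₀ has room for a copy of every E bounded by `l`, so parameters over A ∪ E₀ represent all
  -- relevant ones up to automorphisms fixing A. These parameters range over a set.
  obtain ⟨E₀, hE₀, hdisj, heq⟩ := hPl.exists_disjoint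
    (X := prod l (coll fun z => IsSet z ∧ Sub z l)) hA.1
  obtain ⟨h, k, hh, hk, hhk, -⟩ := heq.exists_defFun
  have instd {ι : Type} (t : (ι → M) → M) [DefTerm t] : DefTerm fun v => h (t v) := hh.comp t
  obtain ⟨m, hm, H⟩ := exists_level_forall_tuple hA (stage (union A E₀) l) κ
    (P := fun a m => (∃ y, Q a y) → HasSolution A m (Q a))
    (by unfold HasSolution; infer_instance)
    (fun a m m' _ _ _ hmm h hy => (h hy).mono hmm) fun a _ => by
      by_cases hy : ∃ y, Q a y
      · obtain ⟨y, hy⟩ := hy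
        obtain ⟨m, hm, h⟩ := exists_level_hasSolution hA hU hy
        exact ⟨m, hm, fun _ => h⟩
      · exact ⟨l, hl, fun h => (hy h).elim⟩
  refine ⟨m, hm, fun E hE a ha ⟨y, hy⟩ => ?_⟩
  have hEE₀ : InjectsInto E fun u => u ∈ᵤ E₀ := by
    obtain ⟨g, hg, hinj, hgl⟩ := injectsInto_iff.1 hE.2
    have instg {ι : Type} (t : (ι → M) → M) [DefTerm t] : DefTerm fun v => g (t v) := hg.comp t
    have hgm : ∀ u, u ∈ᵤ E → g u ∈ᵤ prod l (coll fun z => IsSet z ∧ Sub z l) := by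
      intro u hu
      obtain ⟨z, N, hz, hN, hNl, he⟩ := hgl u hu
      exact mem_prod.2 ⟨z, hz, N, (mem_coll hpow).2 ⟨hN, hNl⟩, he⟩
    refine injectsInto_iff.2 ⟨fun u => h (g u), inferInstance, fun u u' hu hu' he => ?_,
      fun u hu => (hhk _ (hgm u hu)).1⟩
    refine hinj u u' hu hu' ?_
    exact (hhk _ (hgm u hu)).2.symm.trans ((congrArg k he).trans (hhk _ (hgm u' hu')).2)
  -- The parameters are moved over E₀, and the solution found there is pulled back. The bound
  -- survives because `l` and `m` have kernel in A and are fixed.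
  obtain ⟨π, hπA, hπE⟩ := hPl.exists_defAut hA hE.1.1 hE₀ hE.1.2 hdisj hEE₀
  have hπA' : ∀ u, u ∈ᵤ A → π.symm.toFun u = u := fun u hu => by
    conv_lhs => rw [← hπA u hu]
    exact π.left_inv u
  have hπl : π.toFun l = l := π.toFun_eq_self hπA (hl.kernelIn hA)
  have hπm : π.symm.toFun m = m := π.symm.toFun_eq_self hπA' (hm.kernelIn hA)
  obtain ⟨E', y', hE', hi, hy', hQy'⟩ := H (fun k => π.toFun (a k))
    (fun k => by
      have := π.toFun_mem_stage (C := union A E₀) (fun u hu => ?_) (ha k)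
      · rwa [hπl] at this
      · rcases mem_union.1 hu with hu | hu
        · exact mem_union.2 (Or.inl ((hπA u hu).symm ▸ hu))
        · exact mem_union.2 (Or.inr (hπE u hu)))
    ⟨_, hinv π a y hy⟩
  refine ⟨π.symm.toFun E', π.symm.toFun y', ⟨π.symm.isUrSet_map hE'.1, fun u hu huA => ?_⟩,
    π.symm.injectsInto_map hi fun z hz => ?_, ?_, ?_⟩
  · have h : π.toFun u ∈ᵤ E' := π.symm.mem_toFun_iff.1 hu
    exact hE'.2 u (hπA u huA ▸ h) huA
  · rw [← hπm]
    exact (π.symm.mem_iff z m).2 hz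
  · rw [← hπm]
    refine π.symm.toFun_mem_stage (fun u hu => ?_) hy'
    rcases mem_union.1 hu with hu | hu
    · exact mem_union.2 (Or.inl ((hπA' u hu).symm ▸ hu))
    · exact mem_union.2 (Or.inr ((π.symm.mem_iff u E').2 hu))
  · have := hinv π.symm _ _ hQy'
    have he : (fun k => π.symm.toFun (π.toFun (a k))) = a := funext fun k => π.left_inv _
    rwa [he] at this

/-- All subformulas `∀ y, ψ` of the formula have bounded counterexamples. -/
def BoundsCounterexamples (A : M) {n : ℕ} :
    ∀ {k : ℕ}, lang.BoundedFormula (Fin n) k → M → M → Prop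
  | _, .falsum, _, _ => True
  | _, .equal _ _, _, _ => True
  | _, .rel _ _, _, _ => True
  | _, .imp φ ψ, l, m => BoundsCounterexamples A φ l m ∧ BoundsCounterexamples A ψ l m
  | _, .all φ, l, m => BoundsCounterexamples A φ l m ∧ ClosesUnder A (Counterexample φ) l m

theorem defRel_boundsCounterexamples (A : M) {n k : ℕ} (φ : lang.BoundedFormula (Fin n) k) :
    DefRel (BoundsCounterexamples A φ) := by
  induction φ with
  | falsum => exact ⟨DefPred.const⟩
  | equal => exact ⟨DefPred.const⟩
  | rel => exact ⟨DefPred.const⟩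
  | imp φ ψ h1 h2 => exact ⟨DefPred.and (hP := h1.1) (hQ := h2.1)⟩
  | all φ h =>
    exact ⟨DefPred.and (hP := h.1) (hQ := (defRel_closesUnder A (defPred_counterexample φ)).1)⟩

theorem BoundsCounterexamples.mono {A : M} {n k : ℕ} {φ : lang.BoundedFormula (Fin n) k}
    {l m m' : M} (h : BoundsCounterexamples A φ l m) (hm : Sub m m') :
    BoundsCounterexamples A φ l m' := by
  induction φ with
  | falsum => trivial
  | equal => trivial
  | rel => trivial
  | imp φ ψ h1 h2 => exact ⟨h1 h.1, h2 h.2⟩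
  | all φ ih => exact ⟨ih h.1, h.2.mono hm⟩

theorem exists_boundsCounterexamples (hPl : PlenitudePlus M) {A : M} (hA : IsUrSet A)
    (hU : ∀ x : M, IsSet x → InjectsInto x (KernelIn A)) {n k : ℕ}
    (φ : lang.BoundedFormula (Fin n) k) {l : M} (hl : IsLevel A l) :
    ∃ m, IsLevel A m ∧ BoundsCounterexamples A φ l m := by
  have hmax : ∀ m m' : M, IsLevel A m → IsLevel A m' →
      ∃ m'', IsLevel A m'' ∧ Sub m m'' ∧ Sub m' m'' := fun m m' hm hm' =>
    (hm.sub_total hA hm').elim (fun h => ⟨m', hm', h, fun _ h => h⟩)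
      fun h => ⟨m, hm, fun _ h => h, h⟩
  induction φ with
  | falsum => exact ⟨l, hl, trivial⟩
  | equal => exact ⟨l, hl, trivial⟩
  | rel => exact ⟨l, hl, trivial⟩
  | imp φ ψ h1 h2 =>
    obtain ⟨m, hm, h⟩ := h1
    obtain ⟨m', hm', h'⟩ := h2
    obtain ⟨m'', hm'', hs, hs'⟩ := hmax m m' hm hm'
    exact ⟨m'', hm'', h.mono hs, h'.mono hs'⟩
  | all φ ih =>
    obtain ⟨m, hm, h⟩ := ih
    obtain ⟨m', hm', h'⟩ := exists_level_closesUnder hPl hA hU (defPred_counterexample φ)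
      (fun π _ _ h => h.map π) hl
    obtain ⟨m'', hm'', hs, hs'⟩ := hmax m m' hm hm'
    exact ⟨m'', hm'', h.mono hs, h'.mono hs'⟩

end Reflection

/-! ### The reflecting set and the Tarski–Vaught test. -/

section ReflectingSet

variable {M : Type u} [lang.Structure M] {ι κ : Type} [hM : Fact (ModelsZFUR M)]

/-- A set of levels closed under bounding of counterexamples. -/
theorem exists_closed_levels (hPl : PlenitudePlus M) {A : M} (hA : IsUrSet A)
    (hU : ∀ x : M, IsSet x → InjectsInto x (KernelIn A)) {n k : ℕ}
    (φ : lang.BoundedFormula (Fin n) k) {l₀ : M} (hl₀ : IsLevel A l₀) :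
    ∃ C, l₀ ∈ᵤ C ∧ (∀ l, l ∈ᵤ C → IsLevel A l) ∧
      ∀ l, l ∈ᵤ C → ∃ m, m ∈ᵤ C ∧ l ∈ᵤ m ∧ BoundsCounterexamples A φ l m := by
  have inst {ι : Type} (s t : (ι → M) → M) [DefTerm s] [DefTerm t] :
    DefPred fun v => BoundsCounterexamples A φ (s v) (t v) :=
    (defRel_boundsCounterexamples A φ).comp s t
  have hex : ∀ l, IsLevel A l →
      ∃ m, IsLevel A m ∧ l ∈ᵤ m ∧ BoundsCounterexamples A φ l m := by
    intro l hl
    obtain ⟨m, hm, h⟩ := exists_boundsCounterexamples hPl hA hU φ hl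
    obtain ⟨m', hm', hmem⟩ := exists_level_mem A (pair l m)
    exact ⟨m', hm', hmem l (by simp) hl.isSet (hl.kernelIn hA),
      h.mono (hm'.sub_of_mem hA (hmem m (by simp) hm.isSet (hm.kernelIn hA)))⟩
  -- Taking the least suitable level makes the step definable, and the identity off the levels makes
  -- it total, so that it can be iterated.
  let R : M → M → Prop := fun l m => (IsLevel A l ∧
    (IsLevel A m ∧ l ∈ᵤ m ∧ BoundsCounterexamples A φ l m) ∧ ∀ m', IsLevel A m' →
      l ∈ᵤ m' ∧ BoundsCounterexamples A φ l m' → Sub m m') ∨ ¬ IsLevel A l ∧ m = l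
  have hR {ι : Type} (s t : (ι → M) → M) [DefTerm s] [DefTerm t] :
      DefPred fun v => R (s v) (t v) := by
    unfold R; infer_instance
  have huniq : ∀ l, ∃! m, R l m := by
    intro l
    by_cases hl : IsLevel A l
    · simpa only [R, hl, true_and, not_true_eq_false, false_and, or_false] using
        exists_least_level hA (P := fun m => l ∈ᵤ m ∧ BoundsCounterexamples A φ l m) (hex l hl)
    · simp [R, hl]
  choose G hG hGu using huniq
  have hGd : DefFun G := ⟨DefTerm.of_graph (P := fun v m => R (v ()) m) inferInstance
    fun v m => ⟨fun h => h ▸ hG _, hGu _ m⟩⟩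
  obtain ⟨C, h0, hC⟩ := exists_closed_set G l₀
  have hs := small_sep C (IsLevel A)
  refine ⟨_, (mem_coll hs).2 ⟨h0, hl₀⟩, fun l hl => ((mem_coll hs).1 hl).2, fun l hl => ?_⟩
  obtain ⟨hlC, hl⟩ := (mem_coll hs).1 hl
  rcases hG l with h | h
  · exact ⟨G l, (mem_coll hs).2 ⟨hC l hlC, h.2.1.1⟩, h.2.1.2⟩
  · exact (h.1 hl).elim

/-- The urelements coded by pairs `⟨z, N⟩` with `z ∈ N ∈ C` and `N ⊆ l`. -/
noncomputable def coded (C : M) (h : M → M) (l : M) : M :=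
  coll fun u => ∃ z N, N ∈ᵤ C ∧ Sub N l ∧ z ∈ᵤ N ∧ u = h (opair z N)

theorem small_coded (C : M) (h : M → M) [hh : DefFun h] (l : M) :
    Small fun u => ∃ z N, N ∈ᵤ C ∧ Sub N l ∧ z ∈ᵤ N ∧ u = h (opair z N) := by
  have inst {ι : Type} (t : (ι → M) → M) [DefTerm t] : DefTerm fun v => h (t v) := hh.comp t
  have hs := small_image (prod (sUnion C) C) h
  refine small_of_sub (x := coll fun u => ∃ p, p ∈ᵤ prod (sUnion C) C ∧ u = h p) ?_
  rintro _ ⟨z, N, hN, -, hz, rfl⟩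
  exact (mem_coll hs).2 ⟨_, mem_prod.2 ⟨z, mem_sUnion.2 ⟨N, hN, hz⟩, N, hN, rfl⟩, rfl⟩

theorem coded_mono {C : M} {h : M → M} [hh : DefFun h] {l m : M} (hlm : Sub l m) :
    Sub (coded C h l) (coded C h m) := by
  intro u hu
  obtain ⟨z, N, hN, hNl, hz⟩ := (mem_coll (small_coded C h l)).1 hu
  exact (mem_coll (small_coded C h m)).2 ⟨z, N, hN, fun w hw => hlm w (hNl w hw), hz⟩

/-- Every set is included in a transitive set which is closed under counterexamples to the
subformulas of a given formula. -/
theorem exists_isTrans_boundsCounterexamples (hPl : PlenitudePlus M) {A : M} (hA : IsUrSet A)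
    (hU : ∀ x : M, IsSet x → InjectsInto x (KernelIn A)) {n k : ℕ}
    (φ : lang.BoundedFormula (Fin n) k) {x : M} (hx : IsSet x) (hxA : KernelIn A x) :
    ∃ t C : M, ∃ S : M → M, IsTrans t ∧ Sub x t ∧ (∃ l, l ∈ᵤ C) ∧
      (∀ y, y ∈ᵤ t ↔ ∃ l, l ∈ᵤ C ∧ y ∈ᵤ S l) ∧
      (∀ l m, l ∈ᵤ C → m ∈ᵤ C → Sub (S l) (S m) ∨ Sub (S m) (S l)) ∧
      (∀ l, l ∈ᵤ C → ∃ m, m ∈ᵤ C ∧ BoundsCounterexamples A φ l m ∧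
        ∀ {κ : Type} [Finite κ] (Q : (κ → M) → M → Prop),
          (∀ (π : DefAut M) a y, Q a y → Q (fun k => π.toFun (a k)) (π.toFun y)) →
          ClosesUnder A Q l m → ∀ a : κ → M, (∀ k, a k ∈ᵤ S l) → (∃ y, Q a y) →
          ∃ y, y ∈ᵤ t ∧ Q a y) := by
  obtain ⟨l₀, hl₀, hmem₀⟩ := exists_level_mem A (pair x x)
  have hxl₀ : x ∈ᵤ l₀ := hmem₀ x (by simp) hx hxA
  obtain ⟨C, hC₀, hClev, hC⟩ := exists_closed_levels hPl hA hU φ hl₀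
  -- E supplies a block {h(z, N) : z ∈ N} for every N in C; distinct levels have disjoint blocks
  -- because `h` is injective on these pairs.
  obtain ⟨E, hE, hEA, heq⟩ := hPl.exists_disjoint (X := prod (sUnion C) C) hA.1
  obtain ⟨h, k, hh, hk, hhk, -⟩ := heq.exists_defFun
  have inst {ι : Type} (t : (ι → M) → M) [DefTerm t] : DefTerm fun v => h (t v) := hh.comp t
  have instc {ι : Type} (t : (ι → M) → M) [DefTerm t] : DefTerm fun v => coded C h (t v) := by
    unfold coded; infer_instance
  have hX : ∀ z N, N ∈ᵤ C → z ∈ᵤ N → opair z N ∈ᵤ prod (sUnion C) C := fun z N hN hz =>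
    mem_prod.2 ⟨z, mem_sUnion.2 ⟨N, hN, hz⟩, N, hN, rfl⟩
  have hcm := fun l u => mem_coll (small_coded C h l) (z := u)
  have hcE : ∀ l, Sub (coded C h l) E := by
    intro l u hu
    obtain ⟨z, N, hN, -, hz, rfl⟩ := (hcm l u).1 hu
    exact (hhk _ (hX z N hN hz)).1
  have hcU : ∀ l, IsUrSet (coded C h l) := fun l =>
    ⟨isSet_coll (small_coded C h l), fun u hu => hE.2 u (hcE l u hu)⟩
  -- Only blocks of N ⊆ l are admitted at `l`. The urelements so admitted inject into l × P(l),
  -- which is the reason for the bound in `IsBounded`.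
  let S : M → M := fun l => stage (union A (coded C h l)) l
  have hS := small_biUnion C S
  have hSmono : ∀ l m, Sub l m → Sub (S l) (S m) := fun l m hlm z hz =>
    stage_mono_right _ hlm z (stage_mono_left (fun u hu => by
      rw [mem_union] at hu ⊢
      exact hu.imp id (coded_mono hlm u)) l z hz)
  refine ⟨_, C, S, ⟨isSet_coll hS, fun y z hy hz => ?_⟩, fun z hz => ?_, ⟨l₀, hC₀⟩,
    fun y => mem_coll hS, fun l m hl hm => ?_, fun l hl => ?_⟩
  · obtain ⟨l, hl, hy⟩ := (mem_coll hS).1 hy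
    exact (mem_coll hS).2 ⟨l, hl, (isTrans_stage (isUrSet_union hA (hcU l)) l).2 y z hy hz⟩
  · refine (mem_coll hS).2 ⟨l₀, hC₀, ?_⟩
    exact stage_mono_right _ (hl₀.sub_of_mem hA hxl₀) z (stage_mono_left (fun u hu =>
      mem_union.2 (Or.inl hu)) x z (sub_stage_self hxA z hz))
  · exact ((hClev l hl).sub_total hA (hClev m hm)).imp (hSmono l m) (hSmono m l)
  · obtain ⟨m, hm, hlm, hB⟩ := hC l hl
    refine ⟨m, hm, hB, fun {κ} _ Q hinv hcl a ha hy => ?_⟩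
    have hlevm := hClev m hm
    obtain ⟨E', y, hE', hi, hym, hQ⟩ := hcl (coded C h l)
      ⟨⟨hcU l, fun u hu => hEA u (hcE l u hu)⟩, injectsInto_iff.2 ⟨k, hk, fun u u' hu hu' he => by
          obtain ⟨z, N, hN, -, hz, rfl⟩ := (hcm l u).1 hu
          obtain ⟨z', N', hN', -, hz', rfl⟩ := (hcm l u').1 hu'
          rw [(hhk _ (hX z N hN hz)).2, (hhk _ (hX z' N' hN' hz')).2] at he
          rw [he], fun u hu => by
          obtain ⟨z, N, hN, hNl, hz, rfl⟩ := (hcm l u).1 hu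
          exact ⟨z, N, hNl z hz, (hClev N hN).isSet, hNl, (hhk _ (hX z N hN hz)).2⟩⟩⟩ a ha hy
    have hsE' := small_sep E' fun u => ¬ u ∈ᵤ coded C h l
    have hsD := small_image m fun z => h (opair z m)
    obtain ⟨f, hf, hfinj, hfm⟩ := injectsInto_iff.1 hi
    have instf {ι : Type} (t : (ι → M) → M) [DefTerm t] : DefTerm fun v => f (t v) := hf.comp t
    have hDm : Sub (coll fun b => ∃ z, z ∈ᵤ m ∧ b = h (opair z m)) (coded C h m) := by
      intro u hu
      obtain ⟨z, hz, rfl⟩ := (mem_coll hsD).1 hu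
      exact (hcm m _).2 ⟨z, m, hm, fun _ h => h, hz, rfl⟩
    -- The urelements of E' not already available at `l` go into the block of `m`. Everything
    -- available at `l` is fixed, hence so are the parameters.
    obtain ⟨π, hπ, hπ'⟩ := hPl.exists_defAut (B := union A (coded C h l))
      (C := coll fun u => u ∈ᵤ E' ∧ ¬ u ∈ᵤ coded C h l)
      (D := coll fun b => ∃ z, z ∈ᵤ m ∧ b = h (opair z m))
      (isUrSet_union hA (hcU l))
      ⟨isSet_coll hsE', fun u hu => hE'.1.2 u ((mem_coll hsE').1 hu).1⟩
      ⟨isSet_coll hsD, fun u hu => (hcU m).2 u (hDm u hu)⟩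
      (fun u hu huB => by
        obtain ⟨hu, hu'⟩ := (mem_coll hsE').1 hu
        exact (mem_union.1 huB).elim (hE'.2 u hu) hu')
      (fun u hu huB => by
        rcases mem_union.1 huB with huB | huB
        · exact hEA u (hcE m u (hDm u hu)) huB
        · obtain ⟨z, hz, rfl⟩ := (mem_coll hsD).1 hu
          obtain ⟨z', N, hN, hNl, hz', he⟩ := (hcm l _).1 huB
          have he := congrArg k he
          rw [(hhk _ (hX z m hm hz)).2, (hhk _ (hX z' N hN hz')).2] at he
          obtain ⟨rfl, rfl⟩ := opair_inj.1 he
          -- A common urelement would force m ⊆ l; with l ∈ m this gives l ∈ l.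
          exact not_mem_self l (hNl l hlm))
      (injectsInto_iff.2 ⟨fun u => h (opair (f u) m), inferInstance, fun u u' hu hu' he => by
          have hu := ((mem_coll hsE').1 hu).1
          have hu' := ((mem_coll hsE').1 hu').1
          have he := congrArg k he
          simp only [(hhk _ (hX _ m hm (hfm u hu))).2, (hhk _ (hX _ m hm (hfm u' hu'))).2] at he
          exact hfinj u u' hu hu' (opair_inj.1 he).1,
        fun u hu => (mem_coll hsD).2 ⟨f u, hfm u ((mem_coll hsE').1 hu).1, rfl⟩⟩)
    refine ⟨π.toFun y, (mem_coll hS).2 ⟨m, hm, ?_⟩, ?_⟩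
    · have hπm : π.toFun m = m := π.toFun_eq_self (B := A)
        (fun u hu => hπ u (mem_union.2 (Or.inl hu))) (hlevm.kernelIn hA)
      change _ ∈ᵤ stage (union A (coded C h m)) m
      conv => arg 2; arg 2; rw [← hπm]
      refine π.toFun_mem_stage (fun u hu => ?_) hym
      rw [mem_union]
      rcases mem_union.1 hu with huA | huE
      · exact Or.inl ((hπ u (mem_union.2 (Or.inl huA))).symm ▸ huA)
      · by_cases huc : u ∈ᵤ coded C h l
        · rw [hπ u (mem_union.2 (Or.inr huc))]
          exact Or.inr (coded_mono (hlevm.sub_of_mem hA hlm) u huc)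
        · exact Or.inr (hDm _ (hπ' u ((mem_coll hsE').2 ⟨huE, huc⟩)))
    · have hfix : (fun k => π.toFun (a k)) = a := funext fun j =>
        π.toFun_eq_self hπ (.of_mem_stage (isUrSet_union hA (hcU l)) (ha j))
      exact hfix ▸ hinv π a y hQ

theorem reflectionPrinciple (hU : ∃ A : M, IsUniversal A) (hPl : PlenitudePlus M) :
    ReflectionPrinciple M := by
  intro n φ x hx
  obtain ⟨A₀, hA₀, hU₀⟩ := hU
  obtain ⟨T, hT, hxT⟩ := exists_isTrans_mem x
  have hs : Small fun u => InTC u x ∧ IsUr u := small_of_sub (x := T) fun u hu => hu.1 T hT hxT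
  obtain ⟨K, hK, hKm⟩ := hs
  -- With the urelements of `x` added, `x` has kernel in the new set, and every set still injects
  -- into the enlarged class of objects with kernel there.
  have hA := isUrSet_union hA₀ ⟨hK, fun u hu => ((hKm u).1 hu).2⟩
  have hxA : KernelIn (union A₀ K) x := fun u hu hur =>
    mem_union.2 (Or.inr ((hKm u).2 ⟨hu, hur⟩))
  have hU : ∀ y : M, IsSet y → InjectsInto y (KernelIn (union A₀ K)) := fun y hy =>
    (hU₀ y hy).mono fun z hz => (KernelIn.of_inV hA₀ hz).mono fun u hu => mem_union.2 (Or.inl hu)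
  obtain ⟨t, C, S, ht, hxt, ⟨l₀, hl₀⟩, htS, hdir, hcl⟩ :=
    exists_isTrans_boundsCounterexamples hPl hA hU φ hx hxA
  refine ⟨t, ht, hxt, fun a ha => ?_⟩
  -- The S(l) form a chain, so finitely many parameters from `t` already lie in one of them.
  have hcommon : ∀ {κ : Type} [Finite κ] (a : κ → M), (∀ k, a k ∈ᵤ t) →
      ∃ l, l ∈ᵤ C ∧ ∀ k, a k ∈ᵤ S l := by
    intro κ _ a ha
    choose l hl hal using fun k => (htS (a k)).1 (ha k)
    have : Nonempty {l // l ∈ᵤ C} := ⟨⟨l₀, hl₀⟩⟩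
    have : _root_.IsTrans M Sub := ⟨fun _ _ _ h1 h2 z hz => h2 z (h1 z hz)⟩
    have hD : Directed Sub fun l : {l // l ∈ᵤ C} => S l := fun l m =>
      (hdir l m l.2 m.2).elim (fun h => ⟨m, h, fun _ h => h⟩) fun h => ⟨l, fun _ h => h, h⟩
    obtain ⟨m, hm⟩ := hD.finite_le fun k => (⟨l k, hl k⟩ : {l // l ∈ᵤ C})
    exact ⟨m, m.2, fun k => hm k _ (hal k)⟩
  have key : ∀ {k : ℕ} (ψ : lang.BoundedFormula (Fin n) k),
      (∀ l m, BoundsCounterexamples (union A₀ K) φ l m →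
        BoundsCounterexamples (union A₀ K) ψ l m) →
      ∀ xs : Fin k → M, (∀ j, xs j ∈ᵤ t) →
        (ψ.Realize a xs ↔ RealizeIn (fun y => y ∈ᵤ t) ψ a xs) := by
    intro k ψ
    induction ψ with
    | falsum => exact fun _ _ _ => Iff.rfl
    | equal => exact fun _ _ _ => Iff.rfl
    | rel => exact fun _ _ _ => Iff.rfl
    | imp ψ χ h1 h2 =>
      exact fun H xs hxs => imp_congr (h1 (fun l m h => (H l m h).1) xs hxs)
        (h2 (fun l m h => (H l m h).2) xs hxs)
    | @all k ψ ih =>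
      intro H xs hxs
      have ih' : ∀ y, y ∈ᵤ t → (ψ.Realize a (Fin.snoc xs y) ↔
          RealizeIn (fun y => y ∈ᵤ t) ψ a (Fin.snoc xs y)) := fun y hy =>
        ih (fun l m h => (H l m h).1) _ fun j => by
          refine Fin.lastCases ?_ (fun j => ?_) j
          · simpa using hy
          · simpa using hxs j
      constructor
      · exact fun h y hy => (ih' y hy).1 (h y)
      · intro h y
        by_contra hn
        -- Tarski–Vaught: a counterexample anywhere in the universe yields one inside `t` for the
        -- same parameters, and there the induction hypothesis applies.
        obtain ⟨l, hl, hal⟩ := hcommon (Sum.elim a xs) (by rintro (i | j); exacts [ha i, hxs j])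
        obtain ⟨m, -, hB, hQ⟩ := hcl l hl
        obtain ⟨z, hz, hnz⟩ := hQ (Counterexample ψ) (fun π _ _ h => h.map π) (H l m hB).2
          (Sum.elim a xs) hal ⟨y, hn⟩
        exact hnz ((ih' z hz).2 (h z hz))
  exact key φ (fun _ _ h => h) default fun j => j.elim0

end ReflectingSet

end UrelementSet

theorem mainTheorem5 {M : Type*} [UrelementSet.lang.Structure M]
    (hZFUR : UrelementSet.ModelsZFUR M)
    (hUniversal : ∃ A : M, UrelementSet.IsUniversal A)
    (hPlenitude : UrelementSet.PlenitudePlus M) :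
    UrelementSet.ReflectionPrinciple M := by
  have : Fact (UrelementSet.ModelsZFUR M) := ⟨hZFUR⟩
  exact UrelementSet.reflectionPrinciple hUniversal hPlenitude
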